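/- **Setting.** Let $dL$ be Lebesgue measure on $\mathbb{C}$ and $\langle z\rangle=(1+|z|^2)^{1/2}$. Let $$\mathcal{E}=\Big\{u(z)=e^{-|z|^2/2}f(z)\ :\ f \text{ entire}\Big\}\cap L^2(\mathbb{C})$$ be the Bargmann–Fock space and $\Pi$ the orthogonal projection of $L^2(\mathbb{C})$ onto $\mathcal{E}$. For an integer $k\ge 0$ let $L^{2,k}_{\mathcal{E}}=\{u\in\mathcal{E} : \langle z\rangle^k u\in L^2(\mathbb{C})\}$, normed by $\|\langle z\rangle^k u\|_{L^2(\mathbb{C})}$. Consider the system (the case $\sigma=-1$ of the coupled lowest Landau level equations $i\partial_t u=\Pi(|v|^2u)$, $i\partial_t v=\sigma\,\Pi(|u|^2v)$) $$i\partial_t u=\Pi(|v|^2u),\qquad i\partial_t v=-\Pi(|u|^2v),\qquad u(0)=u_0,\quad v(0)=v_0. \tag{$*$}$$ **Theorem 1.5.** Let $k\ge 0$ be an integer. There is a constant $C>0$, depending only on $k$, such that for every $(u_0,v_0)\in L^{2,k}_{\mathcal{E}}\times L^{2,k}_{\mathcal{E}}$ the following holds. There exists a unique solution $(u,v)\in C^\infty(\mathbb{R},L^{2,k}_{\mathcal{E}}\times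 L^{2,k}_{\mathcal{E}})$ to $(*)$, and it satisfies, for all $t\in\mathbb{R}$, $$\|\langle z\rangle^k u(t)\|_{L^2(\mathbb{C})}\le \|\langle z\rangle^k u_0\|_{L^2(\mathbb{C})}\big(1+C\|v_0\|_{L^2(\mathbb{C})}^2|t|\big)^k,$$ $$\|\langle z\rangle^k v(t)\|_{L^2(\mathbb{C})}\le \|\langle z\rangle^k v_0\|_{L^2(\mathbb{C})}\big(1+C\|u_0\|_{L^2(\mathbb{C})}^2|t|\big)^k.$$ Moreover, there is a constant $K$, depending on $k$, $u_0$ and $v_0$ but not on $t$, such that for all $t\in\mathbb{R}$ $$\Big|\|\langle z\rangle^k u(t)\|_{L^2(\mathbb{C})}^2-\|\langle z\rangle^k v(t)\|_{L^2(\mathbb{C})}^2\Big|\le K(1+|t|)^{2k-1}\quad\text{if } k\ge 2,$$ $$\Big|\|\langle z\rangle^k u(t)\|_{L^2(\mathbb{C})}^2-\|\langle z\rangle^k v(t)\|_{L^2(\mathbb{C})}^2\Big|\le K\quad\text{if } k\in\{0,1\}.$$ -/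

import Mathlib

open MeasureTheory
open scoped ContDiff

noncomputable section

namespace LLL

/-- The Japanese bracket `⟨z⟩ = (1 + |z|²)^{1/2}`. -/
def bracket (z : ℂ) : ℝ := Real.sqrt (1 + ‖z‖ ^ 2)

/-- The norm of `L²(ℂ)` with respect to Lebesgue measure. -/
def l2norm (g : ℂ → ℂ) : ℝ := (eLpNorm g 2 volume).toReal

/-- The function `z ↦ ⟨z⟩^k g(z)`. -/
def weighted (k : ℕ) (g : ℂ → ℂ) : ℂ → ℂ := fun z => ((bracket z ^ k : ℝ) : ℂ) * g z

/-- The Bargmann-Fock space `{ u(z) = e^{-|z|²/2} f(z), f entire } ∩ L²(ℂ)`, as a space of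
functions (every class in it has exactly one continuous representative). -/
def Fock : Submodule ℂ (ℂ → ℂ) where
  carrier := {u | (∃ f : ℂ → ℂ, Differentiable ℂ f ∧
      ∀ z, u z = (Real.exp (-(‖z‖ ^ 2) / 2) : ℂ) * f z) ∧ MemLp u 2 volume}
  zero_mem' := ⟨⟨0, differentiable_const 0, by simp⟩, MemLp.zero⟩
  add_mem' := by
    rintro u v ⟨⟨f, hf, huf⟩, hu⟩ ⟨⟨g, hg, hvg⟩, hv⟩
    exact ⟨⟨f + g, hf.add hg, fun z => by simp [huf z, hvg z, mul_add]⟩, hu.add hv⟩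
  smul_mem' := by
    rintro c u ⟨⟨f, hf, huf⟩, hu⟩
    exact ⟨⟨c • f, hf.const_smul c, fun z => by simp [huf z, mul_left_comm]⟩, hu.const_smul c⟩

/-- `Π g = w`, where `Π` is the orthogonal projection of `L²(ℂ)` onto the Bargmann-Fock space:
`g` is in `L²`, `w` is in the Bargmann-Fock space and `g - w` is orthogonal to that space. -/
def IsProj (g w : ℂ → ℂ) : Prop :=
  MemLp g 2 volume ∧ w ∈ Fock ∧
    ∀ h ∈ Fock, ∫ z : ℂ, (g z - w z) * (starRingEnd ℂ) (h z) = 0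

lemma weighted_add (k : ℕ) (u v : ℂ → ℂ) : weighted k (u + v) = weighted k u + weighted k v := by
  funext z; simp [weighted, mul_add]

lemma weighted_smul (k : ℕ) (c : ℂ) (u : ℂ → ℂ) : weighted k (c • u) = c • weighted k u := by
  funext z; simp [weighted, mul_left_comm]

/-- The elements of the Bargmann-Fock space `u` such that `⟨z⟩^k u` is in `L²(ℂ)`. -/
def weightedFock (k : ℕ) : Submodule ℂ (ℂ → ℂ) where
  carrier := {u | u ∈ Fock ∧ MemLp (weighted k u) 2 volume}
  zero_mem' := ⟨Fock.zero_mem, by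
    have h : weighted k 0 = 0 := by funext z; simp [weighted]
    rw [h]; exact MemLp.zero⟩
  add_mem' := by
    rintro u v ⟨hu, hu'⟩ ⟨hv, hv'⟩
    exact ⟨Fock.add_mem hu hv, by rw [weighted_add]; exact hu'.add hv'⟩
  smul_mem' := by
    rintro c u ⟨hu, hu'⟩
    exact ⟨Fock.smul_mem c hu, by rw [weighted_smul]; exact hu'.const_smul c⟩

/-- The space `L^{2,k}_E`. It is a type of its own, so that its topology is the one of the norm
`‖⟨z⟩^k u‖_{L²}` below and not the topology of pointwise convergence. -/
def L2E (k : ℕ) : Type := ↥(weightedFock k)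

namespace L2E

variable {k : ℕ}

instance : AddCommGroup (L2E k) := inferInstanceAs (AddCommGroup ↥(weightedFock k))

instance : Module ℂ (L2E k) := inferInstanceAs (Module ℂ ↥(weightedFock k))

/-- The function underlying an element of `L^{2,k}_E`. -/
def toFun (u : L2E k) : ℂ → ℂ := u.1

instance : CoeFun (L2E k) (fun _ => ℂ → ℂ) := ⟨toFun⟩

lemma ext {u v : L2E k} (h : ∀ z, u z = v z) : u = v := Subtype.ext (funext h)

lemma mem_fock (u : L2E k) : (u : ℂ → ℂ) ∈ Fock := u.2.1

lemma memLp (u : L2E k) : MemLp (weighted k u) 2 volume := u.2.2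

/-- The linear map `u ↦ ⟨z⟩^k u` from `L^{2,k}_E` to `L²(ℂ)`. -/
def toL2 (k : ℕ) : L2E k →ₗ[ℂ] Lp ℂ 2 (volume : Measure ℂ) where
  toFun u := u.memLp.toLp
  map_add' u v := by
    rw [← MemLp.toLp_add]
    exact MemLp.toLp_congr _ _ (Filter.EventuallyEq.of_eq (weighted_add k u v))
  map_smul' c u := by
    rw [RingHom.id_apply, ← MemLp.toLp_const_smul]
    exact MemLp.toLp_congr _ _ (Filter.EventuallyEq.of_eq (weighted_smul k c u))

lemma continuous (u : L2E k) : Continuous (u : ℂ → ℂ) := by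
  obtain ⟨⟨f, hf, huf⟩, -⟩ := u.mem_fock
  have hf' := hf.continuous
  rw [funext huf]
  fun_prop

lemma toL2_injective (k : ℕ) : Function.Injective (toL2 k) := by
  have hpos : ∀ z, bracket z ≠ 0 := fun z => (Real.sqrt_pos.2 (by positivity)).ne'
  have hb : Continuous bracket := by unfold bracket; fun_prop
  intro u v h
  have hae : weighted k u =ᵐ[volume] weighted k v := (MemLp.toLp_eq_toLp_iff u.memLp v.memLp).1 h
  have hu := u.continuous
  have hv := v.continuous
  have heq : weighted k u = weighted k v :=
    (Continuous.ae_eq_iff_eq volume (by unfold weighted; fun_prop)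
      (by unfold weighted; fun_prop)).1 hae
  refine ext fun z => ?_
  have hz := congrFun heq z
  exact mul_left_cancel₀ (by exact_mod_cast pow_ne_zero k (hpos z)) hz

instance : NormedAddCommGroup (L2E k) :=
  NormedAddCommGroup.induced (L2E k) (Lp ℂ 2 (volume : Measure ℂ)) (toL2 k) (toL2_injective k)

/-- The norm of `L^{2,k}_E` is `‖⟨z⟩^k u‖_{L²}`. -/
lemma norm_eq (u : L2E k) : ‖u‖ = l2norm (weighted k u) := Lp.norm_toLp _ u.memLp

instance : NormedSpace ℂ (L2E k) := NormedSpace.induced ℂ (L2E k) (Lp ℂ 2 (volume : Measure ℂ)) (toL2 k)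

end L2E

/-- `(u, v) ∈ C^∞(ℝ, L^{2,k}_E × L^{2,k}_E)` solves `i ∂ₜu = Π(|v|² u)`, `i ∂ₜv = σ Π(|u|² v)`,
`u(0) = u₀`, `v(0) = v₀`. The time derivatives are taken in the normed space `L^{2,k}_E`. -/
structure IsSolution (σ : ℝ) {k : ℕ} (u₀ v₀ : L2E k) (U : ℝ → L2E k × L2E k) : Prop where
  smooth : ContDiff ℝ ∞ U
  init : U 0 = (u₀, v₀)
  eq_u : ∀ t, ∃ w, IsProj (fun z => ((‖(U t).2 z‖ ^ 2 : ℝ) : ℂ) * (U t).1 z) w ∧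
    ∀ z, Complex.I * (deriv U t).1 z = w z
  eq_v : ∀ t, ∃ w, IsProj (fun z => ((‖(U t).1 z‖ ^ 2 : ℝ) : ℂ) * (U t).2 z) w ∧
    ∀ z, Complex.I * (deriv U t).2 z = σ * w z

end LLL

end

open scoped BoundedContinuousFunction

noncomputable section

namespace LLL

/-! ### Integrals over circles -/

/-! The projection `Π` has the kernel `K(z,w) = π⁻¹ exp(z w̄ - |z|²/2 - |w|²/2)`, of modulus `π⁻¹
exp(-|z-w|²/2)`. This Gaussian absorbs any power of `1 + |z-w|`, so weights may be moved between `z`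
and `w`, and Schur's test bounds the resulting operators and forms. As the Bargmann-Fock space
embeds in `L^∞`, the vector field is smooth and locally Lipschitz on the complete space `L^{2,k}_E`.
Uniqueness and smoothness follow, and global existence needs only an a priori bound.

Growth (`exists_growth`): half the time derivative of `‖⟨z⟩^k u‖²` is `transfer v u`, the imaginary
part of `∬ ⟨z⟩^{2k} K(z,w) |v(w)|² u(w) conj(u(z))`. With `⟨w⟩^{2k}` in place of `⟨z⟩^{2k}` the
integral is real, because `K` reproduces `u`. So only `⟨z⟩^{2k} - ⟨w⟩^{2k}` counts, which has one
power of the weight less. Interpolation with the conserved mass then bounds the derivative of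
`‖⟨z⟩^k u‖^{1/k}`.

Difference: the two equations have opposite signs, so the derivative of `‖⟨z⟩^k u‖² - ‖⟨z⟩^k v‖²` is
twice `transfer v u + transfer u v`. Expand `⟨z⟩^{2k} - ⟨w⟩^{2k}` at `w`. The first-order terms of
the two transfers cancel (`form_lin_im_add`): for `u = e^{-|z|²/2} f` and `v = e^{-|z|²/2} g` they
add up to a radial integral of `Im (h conj(z h'))` with `h = f g`, which is half the angular
derivative of `|h|²`. The remainder has two powers of the weight less than the full expression,
hence is `O(|t|^{2k-2})` for large times, and integration gives the power `2k - 1`. For `k = 1` the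
remainder is `|z-w|²`, whose form is real, and for `k = 0` each mass is conserved; in both cases the
difference is constant. -/

lemma integral_eq_zero_of_circle {E : Type*} [NormedAddCommGroup E] [NormedSpace ℝ E]
    (f : ℂ → E) (h : ∀ r : ℝ, 0 < r → ∫ θ in (0 : ℝ)..2 * Real.pi, f (circleMap 0 r θ) = 0) :
    ∫ z, f z = 0 := by
  rw [← Complex.integral_comp_polarCoord_symm]
  by_cases hi : IntegrableOn (fun p : ℝ × ℝ => p.1 • f (Complex.polarCoord.symm p))
    polarCoord.target (volume : Measure (ℝ × ℝ))
  · rw [polarCoord_target] at hi ⊢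
    rw [Measure.volume_eq_prod] at hi ⊢
    rw [setIntegral_prod _ hi]
    refine setIntegral_eq_zero_of_forall_eq_zero fun r hr => ?_
    have hr' : (0 : ℝ) < r := hr
    simp only
    rw [integral_smul]
    have hper : Function.Periodic (fun θ => f (circleMap 0 r θ)) (2 * Real.pi) := by
      intro θ; simp only [periodic_circleMap 0 r θ]
    have h1 := hper.intervalIntegral_add_eq (-Real.pi) 0
    rw [zero_add, h r hr', show -Real.pi + 2 * Real.pi = Real.pi by ring,
      intervalIntegral.integral_of_le (by linarith [Real.pi_pos]), integral_Ioc_eq_integral_Ioo] at h1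
    have h2 : ∀ θ : ℝ, Complex.polarCoord.symm (r, θ) = circleMap 0 r θ := by
      intro θ
      rw [Complex.polarCoord_symm_apply, circleMap, Complex.exp_mul_I]
      simp
    simp only [h2]
    rw [h1, smul_zero]
  -- A non-integrable function has integral `0` by convention, so no integrability hypothesis is
  -- needed.
  · exact integral_undef hi

lemma integral_circle_of_differentiable {F : ℂ → ℂ} (hF : Differentiable ℂ F) (r : ℝ) :
    ∫ θ in (0 : ℝ)..2 * Real.pi, F (circleMap 0 r θ) = 2 * Real.pi * F 0 := by
  have h := (hF.diffContOnCl (s := Metric.ball 0 |r|)).circleAverage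
  rw [Real.circleAverage_def] at h
  rw [← h, Complex.real_smul]
  push_cast
  have : (Real.pi : ℂ) ≠ 0 := by exact_mod_cast Real.pi_ne_zero
  field_simp

lemma norm_circleMap_zero_pos {r : ℝ} (hr : 0 < r) (θ : ℝ) : ‖circleMap 0 r θ‖ = r := by
  simp [abs_of_pos hr]

/-- Mean value property of entire functions, for radial densities. -/
lemma integral_radial_mul {F : ℂ → ℂ} (hF : Differentiable ℂ F) (ρ : ℝ → ℂ)
    (hi : Integrable fun z : ℂ => ρ ‖z‖ * F z) (hρ : Integrable fun z : ℂ => ρ ‖z‖) :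
    ∫ z : ℂ, ρ ‖z‖ * F z = (∫ z : ℂ, ρ ‖z‖) * F 0 := by
  rw [← sub_eq_zero, ← integral_mul_const, ← integral_sub hi (hρ.mul_const _)]
  refine integral_eq_zero_of_circle _ fun r hr => ?_
  simp only [norm_circleMap_zero_pos hr, ← mul_sub]
  rw [intervalIntegral.integral_const_mul,
    integral_circle_of_differentiable (F := fun z => F z - F 0) (hF.sub_const _)]
  simp

/-- The radial formula for the derivative of an entire function. -/
lemma integral_radial_conj_mul {F : ℂ → ℂ} (hF : Differentiable ℂ F) (ρ : ℝ → ℂ)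
    (hi : Integrable fun z : ℂ => ρ ‖z‖ * ((starRingEnd ℂ) z * F z))
    (hρ : Integrable fun z : ℂ => ρ ‖z‖ * (‖z‖ : ℂ) ^ 2) :
    ∫ z : ℂ, ρ ‖z‖ * ((starRingEnd ℂ) z * F z) =
      (∫ z : ℂ, ρ ‖z‖ * (‖z‖ : ℂ) ^ 2) * deriv F 0 := by
  rw [← sub_eq_zero, ← integral_mul_const, ← integral_sub hi (hρ.mul_const _)]
  refine integral_eq_zero_of_circle _ fun r hr => ?_
  have hG : Differentiable ℂ (dslope F 0) := by
    rw [← differentiableOn_univ, Complex.differentiableOn_dslope Filter.univ_mem]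
    exact hF.differentiableOn
  -- On the circle `z̄ z = r²`, so writing `F = F 0 + z G` gives `z̄ F = F 0 z̄ + r² G`. The mean of
  -- `z̄` is zero and that of `G` is `G 0 = F' 0`.
  have key : ∀ z : ℂ, ‖z‖ = r → ρ ‖z‖ * ((starRingEnd ℂ) z * F z) -
      ρ ‖z‖ * (‖z‖ : ℂ) ^ 2 * deriv F 0 =
      ρ r * r ^ 2 * (dslope F 0 z - dslope F 0 0) + ρ r * F 0 * (starRingEnd ℂ) z := by
    intro z hz
    have h1 : F z = F 0 + z * dslope F 0 z := by
      have := sub_smul_dslope F 0 z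
      rw [sub_zero, smul_eq_mul] at this
      rw [this]; ring
    have h2 : (starRingEnd ℂ) z * z = (r : ℂ) ^ 2 := by
      rw [mul_comm, Complex.mul_conj, Complex.normSq_eq_norm_sq, hz]; push_cast; rfl
    rw [hz, dslope_same, h1]
    linear_combination ρ r * dslope F 0 z * h2
  have hc : ∀ θ, ‖circleMap 0 r θ‖ = r := norm_circleMap_zero_pos hr
  have cc : Continuous (circleMap 0 r) := continuous_circleMap 0 r
  have cG : Continuous (dslope F 0) := hG.continuous
  simp only [key _ (hc _)]
  rw [intervalIntegral.integral_add (Continuous.intervalIntegrable (by fun_prop) _ _)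
    (Continuous.intervalIntegrable (by fun_prop) _ _),
    intervalIntegral.integral_const_mul, intervalIntegral.integral_const_mul,
    integral_circle_of_differentiable (F := fun z => dslope F 0 z - dslope F 0 0) (hG.sub_const _)]
  have h3 : ∫ θ in (0 : ℝ)..2 * Real.pi, (starRingEnd ℂ) (circleMap 0 r θ) = 0 := by
    have := integral_circle_of_differentiable (F := fun z => z) differentiable_id r
    rw [mul_zero] at this
    rw [intervalIntegral.integral_of_le (by positivity)] at this ⊢
    rw [integral_conj, this, map_zero]
  rw [h3]; simp

/-- The infinitesimal generator of rotations is symmetric. -/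
lemma integral_radial_im_eq_zero {h : ℂ → ℂ} (hh : Differentiable ℂ h) (ρ : ℝ → ℝ) :
    ∫ z : ℂ, ρ ‖z‖ * (h z * (starRingEnd ℂ) (z * deriv h z)).im = 0 := by
  refine integral_eq_zero_of_circle _ fun r hr => ?_
  simp only [norm_circleMap_zero_pos hr]
  rw [intervalIntegral.integral_const_mul]
  -- The integrand is half the angular derivative of `|h|²`, and a periodic function has derivative
  -- of mean zero.
  have hd : ∀ θ : ℝ, HasDerivAt (fun θ : ℝ => ‖h (circleMap 0 r θ)‖ ^ 2)
      (2 * (h (circleMap 0 r θ) *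
        (starRingEnd ℂ) (circleMap 0 r θ * deriv h (circleMap 0 r θ))).im) θ := by
    intro θ
    have h1 : HasDerivAt (fun θ : ℝ => h (circleMap 0 r θ))
        (deriv h (circleMap 0 r θ) * (circleMap 0 r θ * Complex.I)) θ :=
      (hh _).hasDerivAt.comp θ (hasDerivAt_circleMap 0 r θ)
    have h2 := h1.norm_sq
    convert! h2 using 1
    rw [Complex.inner]
    simp [Complex.mul_re, Complex.mul_im]
    ring
  have hc : Continuous fun θ : ℝ => (2 * (h (circleMap 0 r θ) *
      (starRingEnd ℂ) (circleMap 0 r θ * deriv h (circleMap 0 r θ))).im) := by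
    have c1 : Continuous h := hh.continuous
    have c2 : Continuous (deriv h) := (hh.contDiff (n := 1)).continuous_deriv le_rfl
    have c3 : Continuous (circleMap 0 r) := continuous_circleMap 0 r
    fun_prop
  have hF := intervalIntegral.integral_eq_sub_of_hasDerivAt (a := 0) (b := 2 * Real.pi)
    (fun θ _ => hd θ) (hc.intervalIntegrable _ _)
  rw [intervalIntegral.integral_const_mul] at hF
  have hp : circleMap 0 r (2 * Real.pi) = circleMap 0 r 0 := by
    simpa using periodic_circleMap 0 r 0
  rw [hp, sub_self] at hF
  have h0 := (mul_eq_zero.1 hF).resolve_left two_ne_zero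
  rw [h0, mul_zero]

/-! ### Gaussian integrals -/

lemma integral_exp_neg_norm_sq : ∫ z : ℂ, Real.exp (-‖z‖ ^ 2) = Real.pi := by
  have h := Complex.integral_rpow_mul_exp_neg_mul_rpow (p := 2) (q := 0) (b := 1)
    (by norm_num) (by norm_num) (by norm_num)
  simpa using h

lemma integral_exp_neg_norm_sq_mul : ∫ z : ℂ, Real.exp (-‖z‖ ^ 2) * ‖z‖ ^ 2 = Real.pi := by
  have h := Complex.integral_rpow_mul_exp_neg_mul_rpow (p := 2) (q := 2) (b := 1)
    (by norm_num) (by norm_num) (by norm_num)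
  have h2 : Real.Gamma ((2 + 2) / 2) = 1 := by
    rw [show ((2 : ℝ) + 2) / 2 = 1 + 1 by norm_num, Real.Gamma_add_one one_ne_zero, Real.Gamma_one,
      one_mul]
  rw [h2] at h
  simpa [mul_comm] using h

/-- The Gaussian `exp (-|x|² / 4)`, which dominates the Bargmann-Fock kernel with any
polynomial weight. -/
def gauss (x : ℂ) : ℝ := Real.exp (-(‖x‖ ^ 2) / 4)

lemma gauss_pos (x : ℂ) : 0 < gauss x := Real.exp_pos _

lemma gauss_neg (x : ℂ) : gauss (-x) = gauss x := by simp [gauss]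

@[fun_prop]
lemma continuous_gauss : Continuous gauss := by unfold gauss; fun_prop

/-- The closed formula gives the integral a positive value, whereas it would be `0` for a
non-integrable function. -/
lemma integrable_exp_neg_norm_sq {b : ℝ} (hb : 0 < b) :
    Integrable fun z : ℂ => Real.exp (-b * ‖z‖ ^ 2) := by
  by_contra hi
  have h := Complex.integral_rpow_mul_exp_neg_mul_rpow (p := 2) (q := 0) (b := b)
    (by norm_num) (by norm_num) hb
  have h0 := integral_undef hi
  have hpos : 0 < 2 * Real.pi / 2 * b ^ (-((0 : ℝ) + 2) / 2) * Real.Gamma ((0 + 2) / 2) := by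
    have := Real.pi_pos
    have := Real.Gamma_pos_of_pos (s := (0 + 2) / 2) (by norm_num)
    have := Real.rpow_pos_of_pos hb (-((0 : ℝ) + 2) / 2)
    positivity
  rw [← h] at hpos
  simp only [Real.rpow_zero, one_mul, Real.rpow_two] at hpos
  rw [h0] at hpos
  exact lt_irrefl _ hpos

lemma integrable_gauss : Integrable gauss := by
  have h := integrable_exp_neg_norm_sq (b := 1 / 4) (by norm_num)
  refine h.congr (Filter.Eventually.of_forall fun z => ?_)
  simp only [gauss]; congr 1; ring

lemma memLp_gauss : MemLp (fun x => (gauss x : ℂ)) 2 (volume : Measure ℂ) := by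
  rw [memLp_two_iff_integrable_sq_norm (by fun_prop)]
  have h := integrable_exp_neg_norm_sq (b := 1 / 2) (by norm_num)
  refine h.congr (Filter.Eventually.of_forall fun z => ?_)
  simp only [gauss, Complex.norm_real, Real.norm_eq_abs, sq_abs, ← Real.exp_nat_mul]
  congr 1; push_cast; ring

/-- The total mass of `gauss`. -/
def gaussMass : ℝ := ∫ x, gauss x

lemma gaussMass_nonneg : 0 ≤ gaussMass := integral_nonneg fun x => (gauss_pos x).le

lemma lintegral_gauss_sub (z : ℂ) :
    ∫⁻ w : ℂ, ENNReal.ofReal (gauss (z - w)) = ENNReal.ofReal gaussMass := by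
  rw [gaussMass, ofReal_integral_eq_lintegral_ofReal integrable_gauss
    (Filter.Eventually.of_forall fun x => (gauss_pos x).le)]
  exact lintegral_sub_left_eq_self (fun x => ENNReal.ofReal (gauss x)) z

lemma lintegral_gauss_sub' (z : ℂ) :
    ∫⁻ w : ℂ, ENNReal.ofReal (gauss (w - z)) = ENNReal.ofReal gaussMass := by
  rw [← lintegral_gauss_sub z]
  refine lintegral_congr fun w => ?_
  rw [← gauss_neg, neg_sub]

/-- Polynomial factors are absorbed by the Gaussian. -/
lemma exists_pow_mul_exp_le (n : ℕ) : ∃ c : ℝ, 0 < c ∧ ∀ x : ℂ,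
    (1 + ‖x‖) ^ n * Real.exp (-(‖x‖ ^ 2) / 2) ≤ c * gauss x := by
  -- The factorial comes from `s ^ n / n! ≤ exp s` with `s = 1 + ‖x‖`, and `exp 2` from `1 + ‖x‖ ≤ 2
  -- + ‖x‖² / 4`.
  refine ⟨n.factorial * Real.exp 2, by positivity, fun x => ?_⟩
  have h1 := Real.pow_div_factorial_le_exp (1 + ‖x‖) (by positivity) n
  rw [div_le_iff₀ (by positivity)] at h1
  have h2 : Real.exp (1 + ‖x‖) ≤ Real.exp (2 + ‖x‖ ^ 2 / 4) := by
    apply Real.exp_le_exp.2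
    nlinarith [sq_nonneg (‖x‖ / 2 - 1)]
  calc (1 + ‖x‖) ^ n * Real.exp (-(‖x‖ ^ 2) / 2)
      ≤ (Real.exp (2 + ‖x‖ ^ 2 / 4) * n.factorial) * Real.exp (-(‖x‖ ^ 2) / 2) := by
        gcongr; exact h1.trans (by gcongr)
    _ = n.factorial * (Real.exp (2 + ‖x‖ ^ 2 / 4) * Real.exp (-(‖x‖ ^ 2) / 2)) := by ring
    _ = n.factorial * (Real.exp 2 * gauss x) := by
        rw [gauss, ← Real.exp_add, ← Real.exp_add]; congr 2; ring
    _ = n.factorial * Real.exp 2 * gauss x := by ring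

/-! ### Schur's test for the Gaussian kernel -/

/-- Split the kernel into two square roots and apply Cauchy-Schwarz on the product: in either
variable the kernel has total mass `gaussMass`. -/
lemma lintegral_gauss_bilin {f g : ℂ → ENNReal} (hf : Measurable f) (hg : Measurable g) :
    ∫⁻ p : ℂ × ℂ, ENNReal.ofReal (gauss (p.1 - p.2)) * (f p.1 * g p.2)
      ∂(volume : Measure ℂ).prod volume ≤
    ENNReal.ofReal gaussMass * ((∫⁻ z, f z ^ (2 : ℝ)) ^ (1 / 2 : ℝ) * (∫⁻ z, g z ^ (2 : ℝ)) ^ (1 / 2 : ℝ)) := by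
  set κ : ℂ → ENNReal := fun x => ENNReal.ofReal (gauss x) with hκ
  have mκ : Measurable κ := by
    have := continuous_gauss.measurable
    fun_prop
  have e : ∀ p : ℂ × ℂ, ENNReal.ofReal (gauss (p.1 - p.2)) * (f p.1 * g p.2) =
      ((fun p : ℂ × ℂ => κ (p.1 - p.2) ^ (1 / 2 : ℝ) * f p.1) *
        (fun p : ℂ × ℂ => κ (p.1 - p.2) ^ (1 / 2 : ℝ) * g p.2)) p := by
    intro p
    have : κ (p.1 - p.2) = κ (p.1 - p.2) ^ (1 / 2 : ℝ) * κ (p.1 - p.2) ^ (1 / 2 : ℝ) := by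
      rw [← ENNReal.rpow_add_of_nonneg _ _ (by norm_num) (by norm_num)]; norm_num
    simp only [Pi.mul_apply]
    change κ (p.1 - p.2) * _ = _
    conv_lhs => rw [this]
    ring
  simp only [e]
  refine (ENNReal.lintegral_mul_le_Lp_mul_Lq _ Real.HolderConjugate.two_two
    (by fun_prop) (by fun_prop)).trans ?_
  have sq : ∀ a b : ENNReal, (a ^ (1 / 2 : ℝ) * b) ^ (2 : ℝ) = a * b ^ (2 : ℝ) := by
    intro a b
    rw [ENNReal.mul_rpow_of_nonneg _ _ (by norm_num), ← ENNReal.rpow_mul]; norm_num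
  simp only [sq]
  have h1 : ∫⁻ p : ℂ × ℂ, κ (p.1 - p.2) * f p.1 ^ (2 : ℝ) ∂(volume : Measure ℂ).prod volume =
      ENNReal.ofReal gaussMass * ∫⁻ z, f z ^ (2 : ℝ) := by
    rw [lintegral_prod _ (by fun_prop), ← lintegral_const_mul _ (by fun_prop)]
    refine lintegral_congr fun z => ?_
    simp only
    rw [lintegral_mul_const _ (by fun_prop), lintegral_gauss_sub]
  have h2 : ∫⁻ p : ℂ × ℂ, κ (p.1 - p.2) * g p.2 ^ (2 : ℝ) ∂(volume : Measure ℂ).prod volume =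
      ENNReal.ofReal gaussMass * ∫⁻ z, g z ^ (2 : ℝ) := by
    rw [lintegral_prod_symm _ (by fun_prop), ← lintegral_const_mul _ (by fun_prop)]
    refine lintegral_congr fun z => ?_
    simp only
    rw [lintegral_mul_const _ (by fun_prop), lintegral_gauss_sub']
  rw [h1, h2, ENNReal.mul_rpow_of_nonneg _ _ (by norm_num),
    ENNReal.mul_rpow_of_nonneg _ _ (by norm_num)]
  refine le_of_eq ?_
  set m := ENNReal.ofReal gaussMass
  have : m = m ^ (1 / 2 : ℝ) * m ^ (1 / 2 : ℝ) := by
    rw [← ENNReal.rpow_add_of_nonneg _ _ (by norm_num) (by norm_num)]; norm_num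
  conv_rhs => rw [this]
  ring

/-- Cauchy-Schwarz in `w` with half of the kernel on each side, then Tonelli. -/
lemma lintegral_gauss_conv_sq {f : ℂ → ENNReal} (hf : Measurable f) :
    ∫⁻ z, (∫⁻ w, ENNReal.ofReal (gauss (z - w)) * f w) ^ (2 : ℝ) ≤
      ENNReal.ofReal gaussMass ^ (2 : ℝ) * ∫⁻ z, f z ^ (2 : ℝ) := by
  set κ : ℂ → ENNReal := fun x => ENNReal.ofReal (gauss x) with hκ
  have mκ : Measurable κ := by
    have := continuous_gauss.measurable
    fun_prop
  have hp : ∀ z, (∫⁻ w, κ (z - w) * f w) ^ (2 : ℝ) ≤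
      ENNReal.ofReal gaussMass * ∫⁻ w, κ (z - w) * f w ^ (2 : ℝ) := by
    intro z
    have e : ∀ w, κ (z - w) * f w = ((fun w => κ (z - w) ^ (1 / 2 : ℝ)) *
        (fun w => κ (z - w) ^ (1 / 2 : ℝ) * f w)) w := by
      intro w
      have : κ (z - w) = κ (z - w) ^ (1 / 2 : ℝ) * κ (z - w) ^ (1 / 2 : ℝ) := by
        rw [← ENNReal.rpow_add_of_nonneg _ _ (by norm_num) (by norm_num)]; norm_num
      simp only [Pi.mul_apply]
      conv_lhs => rw [this]
      ring
    simp only [e]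
    refine (ENNReal.rpow_le_rpow (ENNReal.lintegral_mul_le_Lp_mul_Lq _ Real.HolderConjugate.two_two
      (by fun_prop) (by fun_prop)) (by norm_num)).trans (le_of_eq ?_)
    have s1 : ∀ a : ENNReal, (a ^ (1 / 2 : ℝ)) ^ (2 : ℝ) = a := by
      intro a; rw [← ENNReal.rpow_mul]; norm_num
    rw [ENNReal.mul_rpow_of_nonneg _ _ (by norm_num), s1, s1]
    simp only [s1, ENNReal.mul_rpow_of_nonneg _ _ (show (0 : ℝ) ≤ 2 by norm_num)]
    rw [lintegral_gauss_sub]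
  refine (lintegral_mono hp).trans (le_of_eq ?_)
  rw [lintegral_const_mul _ (by fun_prop), lintegral_lintegral_swap (by fun_prop)]
  have : ∀ w, ∫⁻ z, κ (z - w) * f w ^ (2 : ℝ) = ENNReal.ofReal gaussMass * f w ^ (2 : ℝ) := by
    intro w
    rw [lintegral_mul_const _ (by fun_prop), lintegral_gauss_sub']
  simp only [this]
  rw [lintegral_const_mul _ (by fun_prop), ← mul_assoc, ENNReal.rpow_two, sq]

lemma eLpNorm_two_eq (f : ℂ → ℂ) :
    eLpNorm f 2 (volume : Measure ℂ) = (∫⁻ z, ‖f z‖ₑ ^ (2 : ℝ)) ^ (1 / 2 : ℝ) := by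
  rw [eLpNorm_eq_lintegral_rpow_enorm_toReal (by norm_num) (by norm_num)]
  simp

/-- Schur's test, bilinear form. -/
lemma integrable_and_norm_integral_le_of_gauss {f g : ℂ → ℂ} (hf : Continuous f)
    (hg : Continuous g) (hf2 : MemLp f 2 volume) (hg2 : MemLp g 2 volume) {c : ℝ} (hc : 0 ≤ c)
    {Φ : ℂ × ℂ → ℂ} (hΦ : Continuous Φ)
    (h : ∀ z w, ‖Φ (z, w)‖ ≤ c * gauss (z - w) * (‖f z‖ * ‖g w‖)) :
    Integrable Φ ((volume : Measure ℂ).prod volume) ∧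
    ‖∫ p, Φ p ∂(volume : Measure ℂ).prod volume‖ ≤ c * gaussMass * (l2norm f * l2norm g) := by
  have hb : ∫⁻ p, ‖Φ p‖ₑ ∂(volume : Measure ℂ).prod volume ≤
      ENNReal.ofReal (c * gaussMass * (l2norm f * l2norm g)) := by
    have h1 : ∀ p : ℂ × ℂ, ‖Φ p‖ₑ ≤
        ENNReal.ofReal c * (ENNReal.ofReal (gauss (p.1 - p.2)) * (‖f p.1‖ₑ * ‖g p.2‖ₑ)) := by
      intro p
      rw [← ofReal_norm, ← ofReal_norm, ← ofReal_norm,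
        ← ENNReal.ofReal_mul (norm_nonneg _), ← ENNReal.ofReal_mul (gauss_pos _).le,
        ← ENNReal.ofReal_mul hc, ← mul_assoc]
      exact ENNReal.ofReal_le_ofReal (h p.1 p.2)
    refine (lintegral_mono h1).trans ?_
    have m1 := continuous_gauss.measurable
    have m2 := hf.measurable
    have m3 := hg.measurable
    rw [lintegral_const_mul _ (by fun_prop)]
    refine (mul_le_mul_right (lintegral_gauss_bilin m2.enorm m3.enorm) _).trans
      (le_of_eq ?_)
    rw [← eLpNorm_two_eq, ← eLpNorm_two_eq, l2norm, l2norm, mul_assoc, ENNReal.ofReal_mul hc,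
      ENNReal.ofReal_mul gaussMass_nonneg, ENNReal.ofReal_mul ENNReal.toReal_nonneg,
      ENNReal.ofReal_toReal hf2.eLpNorm_ne_top, ENNReal.ofReal_toReal hg2.eLpNorm_ne_top]
  refine ⟨⟨hΦ.aestronglyMeasurable, lt_of_le_of_lt hb ENNReal.ofReal_lt_top⟩, ?_⟩
  have h0 : 0 ≤ c * gaussMass * (l2norm f * l2norm g) :=
    mul_nonneg (mul_nonneg hc gaussMass_nonneg)
      (mul_nonneg ENNReal.toReal_nonneg ENNReal.toReal_nonneg)
  have h2 := (enorm_integral_le_lintegral_enorm Φ).trans hb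
  rw [← ofReal_norm] at h2
  exact (ENNReal.ofReal_le_ofReal_iff h0).1 h2

/-- Schur's test, operator form. -/
lemma memLp_and_l2norm_le_of_gauss {f N : ℂ → ℂ} (hf : Continuous f) (hN : Continuous N)
    (hf2 : MemLp f 2 volume) {c : ℝ} (hc : 0 ≤ c)
    (h : ∀ z, ‖N z‖ₑ ≤ ENNReal.ofReal c * ∫⁻ w, ENNReal.ofReal (gauss (z - w)) * ‖f w‖ₑ) :
    MemLp N 2 volume ∧ l2norm N ≤ c * gaussMass * l2norm f := by
  have hb : eLpNorm N 2 volume ≤ ENNReal.ofReal (c * gaussMass * l2norm f) := by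
    have h1 : ∫⁻ z, ‖N z‖ₑ ^ (2 : ℝ) ≤ ENNReal.ofReal c ^ (2 : ℝ) *
        (ENNReal.ofReal gaussMass ^ (2 : ℝ) * ∫⁻ z, ‖f z‖ₑ ^ (2 : ℝ)) := by
      have m1 := continuous_gauss.measurable
      have m2 := hf.measurable
      refine (lintegral_mono fun z => ENNReal.rpow_le_rpow (h z) (by norm_num : (0 : ℝ) ≤ 2)).trans ?_
      simp only [ENNReal.mul_rpow_of_nonneg _ _ (show (0 : ℝ) ≤ 2 by norm_num)]
      rw [lintegral_const_mul _ (by fun_prop)]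
      gcongr
      exact lintegral_gauss_conv_sq (by fun_prop)
    have s1 : ∀ a : ENNReal, (a ^ (2 : ℝ)) ^ (1 / 2 : ℝ) = a := by
      intro a; rw [← ENNReal.rpow_mul]; norm_num
    rw [eLpNorm_two_eq]
    refine (ENNReal.rpow_le_rpow h1 (by norm_num)).trans (le_of_eq ?_)
    rw [ENNReal.mul_rpow_of_nonneg _ _ (by norm_num), ENNReal.mul_rpow_of_nonneg _ _ (by norm_num),
      s1, s1, ← eLpNorm_two_eq, mul_assoc, ENNReal.ofReal_mul hc,
      ENNReal.ofReal_mul gaussMass_nonneg, l2norm, ENNReal.ofReal_toReal hf2.eLpNorm_ne_top]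
  refine ⟨⟨hN.aestronglyMeasurable, lt_of_le_of_lt hb ENNReal.ofReal_lt_top⟩, ?_⟩
  exact ENNReal.toReal_le_of_le_ofReal
    (mul_nonneg (mul_nonneg hc gaussMass_nonneg) ENNReal.toReal_nonneg) hb

lemma l2norm_nonneg (f : ℂ → ℂ) : 0 ≤ l2norm f := ENNReal.toReal_nonneg

lemma norm_integral_mul_le {f g : ℂ → ℂ} (hf : MemLp f 2 volume) (hg : MemLp g 2 volume) :
    ‖∫ z, f z * g z‖ ≤ l2norm f * l2norm g := by
  have h1 : ∫⁻ z, ‖f z * g z‖ₑ ≤ eLpNorm f 2 volume * eLpNorm g 2 volume := by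
    have e : ∀ z, ‖f z * g z‖ₑ = ((fun z => ‖f z‖ₑ) * (fun z => ‖g z‖ₑ)) z := fun z => by simp
    simp only [e]
    rw [eLpNorm_two_eq, eLpNorm_two_eq]
    exact ENNReal.lintegral_mul_le_Lp_mul_Lq _ Real.HolderConjugate.two_two
      hf.aestronglyMeasurable.enorm hg.aestronglyMeasurable.enorm
  have h2 := (enorm_integral_le_lintegral_enorm (fun z => f z * g z)).trans h1
  rw [← ofReal_norm] at h2
  rw [l2norm, l2norm, ← ENNReal.toReal_mul]
  exact (ENNReal.ofReal_le_iff_le_toReal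
    (ENNReal.mul_ne_top hf.eLpNorm_ne_top hg.eLpNorm_ne_top)).1 h2

/-! ### The Bargmann-Fock kernel -/

/-- The integral kernel of `Π`. -/
def ker (z w : ℂ) : ℂ :=
  (Real.pi : ℂ)⁻¹ * Complex.exp (z * (starRingEnd ℂ) w - (‖z‖ : ℂ) ^ 2 / 2 - (‖w‖ : ℂ) ^ 2 / 2)

@[fun_prop]
lemma continuous_ker : Continuous fun p : ℂ × ℂ => ker p.1 p.2 := by
  unfold ker; fun_prop

lemma continuous_ker_left (w : ℂ) : Continuous fun z => ker z w :=
  continuous_ker.comp (by fun_prop : Continuous fun z => (z, w))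

lemma continuous_ker_right (z : ℂ) : Continuous (ker z) :=
  continuous_ker.comp (by fun_prop : Continuous fun w => (z, w))

lemma conj_ker (z w : ℂ) : (starRingEnd ℂ) (ker z w) = ker w z := by
  simp only [ker, map_mul, map_inv₀, Complex.conj_ofReal, ← Complex.exp_conj, map_sub, map_div₀,
    map_pow, Complex.conj_conj, map_ofNat]
  congr 2; ring

lemma norm_sq_sub (z w : ℂ) :
    ‖z - w‖ ^ 2 = ‖z‖ ^ 2 - 2 * (z * (starRingEnd ℂ) w).re + ‖w‖ ^ 2 := by
  simp only [← Complex.normSq_eq_norm_sq, Complex.normSq_apply, Complex.sub_re, Complex.sub_im,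
    Complex.mul_re, Complex.conj_re, Complex.conj_im]
  ring

/-- Completing the square: `Re (z w̄) - |z|²/2 - |w|²/2 = -|z-w|²/2`. All the estimates rest on this
off-diagonal decay. -/
lemma norm_ker (z w : ℂ) : ‖ker z w‖ = Real.pi⁻¹ * Real.exp (-(‖z - w‖ ^ 2) / 2) := by
  rw [ker, norm_mul, Complex.norm_exp, norm_inv, Complex.norm_real, Real.norm_eq_abs,
    abs_of_pos Real.pi_pos, norm_sq_sub]
  congr 2
  simp only [Complex.sub_re, Complex.div_ofNat_re, ← Complex.ofReal_pow, Complex.ofReal_re]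
  ring

lemma exists_pow_mul_norm_ker_le (n : ℕ) : ∃ c : ℝ, 0 < c ∧ ∀ z w : ℂ,
    (1 + ‖z - w‖) ^ n * ‖ker z w‖ ≤ c * gauss (z - w) := by
  obtain ⟨c, hc, h⟩ := exists_pow_mul_exp_le n
  refine ⟨Real.pi⁻¹ * c, by have := Real.pi_pos; positivity, fun z w => ?_⟩
  rw [norm_ker]
  have := mul_le_mul_of_nonneg_left (h (z - w)) (inv_nonneg.2 Real.pi_pos.le)
  linarith

lemma memLp_gauss_sub (w : ℂ) : MemLp (fun z => (gauss (z - w) : ℂ)) 2 (volume : Measure ℂ) :=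
  memLp_gauss.comp_measurePreserving (measurePreserving_sub_right volume w)

lemma gauss_sub_comm (z w : ℂ) : gauss (z - w) = gauss (w - z) := by
  rw [← gauss_neg, neg_sub]

lemma memLp_ker_left (w : ℂ) : MemLp (fun z => ker z w) 2 volume := by
  obtain ⟨c, hc, h⟩ := exists_pow_mul_norm_ker_le 0
  refine (memLp_gauss_sub w).of_le_mul (c := c) (continuous_ker_left w).aestronglyMeasurable
    (Filter.Eventually.of_forall fun z => ?_)
  have := h z w
  rw [pow_zero, one_mul] at this
  rwa [Complex.norm_real, Real.norm_eq_abs, abs_of_pos (gauss_pos _)]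

lemma ker_mem_fock (w : ℂ) : (fun z => ker z w) ∈ Fock := by
  refine ⟨⟨fun z => (Real.pi : ℂ)⁻¹ * Complex.exp (z * (starRingEnd ℂ) w - (‖w‖ : ℂ) ^ 2 / 2),
    by fun_prop, fun z => ?_⟩, memLp_ker_left w⟩
  simp only [ker]
  rw [mul_left_comm, Complex.ofReal_exp, ← Complex.exp_add]
  congr 2; push_cast; ring

lemma continuous_of_mem_fock {u : ℂ → ℂ} (hu : u ∈ Fock) : Continuous u := by
  obtain ⟨⟨f, hf, huf⟩, -⟩ := hu
  have hf' := hf.continuous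
  rw [funext huf]
  fun_prop

/-! ### Reproducing formulas -/

lemma integrable_ker_mul {q u : ℂ → ℂ} (hq : Continuous q) (n : ℕ)
    (hqn : ∀ x, ‖q x‖ ≤ (1 + ‖x‖) ^ n) (hu : MemLp u 2 volume) (w : ℂ) :
    Integrable fun z => ker w z * (q (z - w) * u z) := by
  obtain ⟨c, hc, h⟩ := exists_pow_mul_norm_ker_le n
  have hi := ((memLp_gauss_sub w).integrable_mul hu).norm.const_mul c
  refine hi.mono' ?_ (Filter.Eventually.of_forall fun z => ?_)
  · have := continuous_ker_right w
    exact this.aestronglyMeasurable.mul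
      ((by fun_prop : Continuous fun z => q (z - w)).aestronglyMeasurable.mul hu.aestronglyMeasurable)
  · simp only [Pi.mul_apply, norm_mul, Complex.norm_real, Real.norm_eq_abs, abs_of_pos (gauss_pos _)]
    have h1 := h w z
    rw [norm_sub_rev, gauss_sub_comm] at h1
    calc ‖ker w z‖ * (‖q (z - w)‖ * ‖u z‖) ≤ ‖ker w z‖ * ((1 + ‖z - w‖) ^ n * ‖u z‖) := by
          gcongr; exact hqn _
      _ = ((1 + ‖z - w‖) ^ n * ‖ker w z‖) * ‖u z‖ := by ring
      _ ≤ (c * gauss (z - w)) * ‖u z‖ := by gcongr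
      _ = _ := by ring

section Reproducing

variable {u f : ℂ → ℂ}

/-- The recentred holomorphic part. -/
def recentre (f : ℂ → ℂ) (w x : ℂ) : ℂ := Complex.exp (-(x * (starRingEnd ℂ) w)) * f (x + w)

lemma differentiable_recentre (hf : Differentiable ℂ f) (w : ℂ) :
    Differentiable ℂ (recentre f w) := by
  unfold recentre; fun_prop

lemma recentre_zero (f : ℂ → ℂ) (w : ℂ) : recentre f w 0 = f w := by simp [recentre]

lemma deriv_recentre_zero (hf : Differentiable ℂ f) (w : ℂ) :
    deriv (recentre f w) 0 = deriv f w - (starRingEnd ℂ) w * f w := by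
  have h1 : HasDerivAt (fun x : ℂ => Complex.exp (-(x * (starRingEnd ℂ) w)))
      (Complex.exp (-(0 * (starRingEnd ℂ) w)) * (-(1 * (starRingEnd ℂ) w))) 0 :=
    (((hasDerivAt_id (0 : ℂ)).mul_const _).neg).cexp
  have h2 : HasDerivAt (fun x : ℂ => f (x + w)) (deriv f (0 + w)) 0 :=
    (hf (0 + w)).hasDerivAt.comp_add_const 0 w
  have h3 := (h1.mul h2).deriv
  change deriv (fun x => Complex.exp (-(x * (starRingEnd ℂ) w)) * f (x + w)) 0 = _
  erw [h3]
  simp; ring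

/-- Recentring at `w` turns kernel times `u` into a radial Gaussian times an entire function, to
which the mean value formulas apply. -/
lemma ker_mul_recentre (hu : ∀ z, u z = (Real.exp (-(‖z‖ ^ 2) / 2) : ℂ) * f z) (w x a : ℂ) :
    ker w (x + w) * (a * u (x + w)) =
      (Real.pi : ℂ)⁻¹ * (Real.exp (-(‖w‖ ^ 2) / 2) : ℂ) *
        ((Real.exp (-‖x‖ ^ 2) : ℂ) * (a * recentre f w x)) := by
  have key : Complex.exp (w * (starRingEnd ℂ) (x + w) - (‖w‖ : ℂ) ^ 2 / 2 -
      (‖x + w‖ : ℂ) ^ 2 / 2) * (Real.exp (-(‖x + w‖ ^ 2) / 2) : ℂ) =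
      (Real.exp (-(‖w‖ ^ 2) / 2) : ℂ) * (Real.exp (-‖x‖ ^ 2) : ℂ) *
        Complex.exp (-(x * (starRingEnd ℂ) w)) := by
    have n2 : ∀ y : ℂ, (‖y‖ : ℂ) ^ 2 = y * (starRingEnd ℂ) y := fun y => by
      rw [Complex.mul_conj, Complex.normSq_eq_norm_sq]; push_cast; rfl
    simp only [Complex.ofReal_exp, ← Complex.exp_add]
    congr 1
    push_cast
    simp only [n2, map_add]
    ring
  rw [hu, recentre, ker]
  linear_combination (Real.pi : ℂ)⁻¹ * a * f (x + w) * key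

variable (hf : Differentiable ℂ f)
  (hu : ∀ z, u z = (Real.exp (-(‖z‖ ^ 2) / 2) : ℂ) * f z) (h2 : MemLp u 2 volume)

include hu in
lemma integral_ker_mul_eq (q : ℂ → ℂ) (w : ℂ) :
    ∫ z, ker w z * (q (z - w) * u z) = (Real.pi : ℂ)⁻¹ * (Real.exp (-(‖w‖ ^ 2) / 2) : ℂ) *
      ∫ x : ℂ, (Real.exp (-‖x‖ ^ 2) : ℂ) * (q x * recentre f w x) := by
  rw [← integral_const_mul, ← integral_add_right_eq_self _ w]
  refine integral_congr_ae (Filter.Eventually.of_forall fun x => ?_)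
  simp only [add_sub_cancel_right]
  exact ker_mul_recentre hu w x (q x)

include hu h2 in
lemma integrable_recentre {q : ℂ → ℂ} (hq : Continuous q) (n : ℕ)
    (hqn : ∀ x, ‖q x‖ ≤ (1 + ‖x‖) ^ n) (w : ℂ) :
    Integrable fun x : ℂ => (Real.exp (-‖x‖ ^ 2) : ℂ) * (q x * recentre f w x) := by
  have h := (integrable_ker_mul hq n hqn h2 w).comp_add_right w
  simp only [add_sub_cancel_right, ker_mul_recentre hu] at h
  refine (integrable_const_mul_iff (IsUnit.mk0 _ ?_) _).1 h
  have : (Real.pi : ℂ) ≠ 0 := by exact_mod_cast Real.pi_ne_zero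
  simp [this]

lemma integral_cexp_neg_norm_sq : ∫ z : ℂ, (Real.exp (-‖z‖ ^ 2) : ℂ) = Real.pi := by
  rw [integral_complex_ofReal, integral_exp_neg_norm_sq]

lemma integral_cexp_neg_norm_sq_mul :
    ∫ z : ℂ, (Real.exp (-‖z‖ ^ 2) : ℂ) * (‖z‖ : ℂ) ^ 2 = Real.pi := by
  rw [← integral_exp_neg_norm_sq_mul, ← integral_complex_ofReal]
  push_cast; rfl

lemma integrable_cexp_neg_norm_sq : Integrable fun z : ℂ => (Real.exp (-‖z‖ ^ 2) : ℂ) := by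
  by_contra h
  have := integral_undef h
  rw [integral_cexp_neg_norm_sq] at this
  exact Real.pi_ne_zero (by exact_mod_cast this)

lemma integrable_cexp_neg_norm_sq_mul :
    Integrable fun z : ℂ => (Real.exp (-‖z‖ ^ 2) : ℂ) * (‖z‖ : ℂ) ^ 2 := by
  by_contra h
  have := integral_undef h
  rw [integral_cexp_neg_norm_sq_mul] at this
  exact Real.pi_ne_zero (by exact_mod_cast this)

include hf hu h2

lemma integral_ker_mul_self (w : ℂ) : ∫ z, ker w z * u z = u w := by
  have h := integral_ker_mul_eq hu (fun _ => 1) w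
  have hi := integrable_recentre hu h2 (q := fun _ => 1) (by fun_prop) 0 (by simp) w
  simp only [one_mul] at h hi
  rw [h, integral_radial_mul (differentiable_recentre hf w) (fun r => (Real.exp (-r ^ 2) : ℂ)) hi
    integrable_cexp_neg_norm_sq, integral_cexp_neg_norm_sq, recentre_zero, hu w]
  have : (Real.pi : ℂ) ≠ 0 := by exact_mod_cast Real.pi_ne_zero
  field_simp

/-- After recentring, the entire factor `x * recentre f w x` vanishes at the centre. -/
lemma integral_ker_mul_sub (w : ℂ) : ∫ z, ker w z * ((z - w) * u z) = 0 := by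
  have h := integral_ker_mul_eq hu (fun x => x) w
  have hi := integrable_recentre hu h2 (q := fun x => x) (by fun_prop) 1 (by simp) w
  rw [h, integral_radial_mul (F := fun x => x * recentre f w x)
    (differentiable_id.mul (differentiable_recentre hf w)) (fun r => (Real.exp (-r ^ 2) : ℂ)) hi
    integrable_cexp_neg_norm_sq]
  simp

lemma integral_ker_mul_conj_sub (w : ℂ) : ∫ z, ker w z * ((starRingEnd ℂ) (z - w) * u z) =
    (Real.exp (-(‖w‖ ^ 2) / 2) : ℂ) * (deriv f w - (starRingEnd ℂ) w * f w) := by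
  have h := integral_ker_mul_eq hu (fun x => (starRingEnd ℂ) x) w
  have hi := integrable_recentre hu h2 (q := fun x => (starRingEnd ℂ) x) (by fun_prop) 1 (by simp) w
  rw [h, integral_radial_conj_mul (differentiable_recentre hf w)
    (fun r => (Real.exp (-r ^ 2) : ℂ)) hi integrable_cexp_neg_norm_sq_mul,
    integral_cexp_neg_norm_sq_mul, deriv_recentre_zero hf]
  have : (Real.pi : ℂ) ≠ 0 := by exact_mod_cast Real.pi_ne_zero
  field_simp

/-- The Gaussian moments of `1` and of `|x|²` are both `π`, hence the factor `1`. -/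
lemma integral_ker_mul_norm_sq_sub (w : ℂ) : ∫ z, ker w z * ((‖z - w‖ : ℂ) ^ 2 * u z) = u w := by
  have h := integral_ker_mul_eq hu (fun x => (‖x‖ : ℂ) ^ 2) w
  have hi := integrable_recentre hu h2 (q := fun x => (‖x‖ : ℂ) ^ 2) (by fun_prop) 2
    (fun x => by
      simp only [norm_pow, Complex.norm_real, norm_norm]
      gcongr; linarith) w
  have hi' : Integrable fun x : ℂ =>
      (fun r : ℝ => (Real.exp (-r ^ 2) : ℂ) * (r : ℂ) ^ 2) ‖x‖ * recentre f w x := by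
    simpa only [mul_assoc] using hi
  have h' := integral_radial_mul (differentiable_recentre hf w)
    (fun r => (Real.exp (-r ^ 2) : ℂ) * (r : ℂ) ^ 2) hi' integrable_cexp_neg_norm_sq_mul
  rw [integral_cexp_neg_norm_sq_mul, recentre_zero] at h'
  simp only [mul_assoc] at h'
  rw [h, h', hu w]
  have : (Real.pi : ℂ) ≠ 0 := by exact_mod_cast Real.pi_ne_zero
  field_simp

end Reproducing

lemma ker_reproduces {u : ℂ → ℂ} (hu : u ∈ Fock) (w : ℂ) : ∫ z, ker w z * u z = u w := by
  obtain ⟨⟨f, hf, huf⟩, h2⟩ := hu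
  exact integral_ker_mul_self hf huf h2 w

lemma l2norm_ker_right_le : ∃ c : ℝ, 0 < c ∧ ∀ z, l2norm (ker z) ≤ c := by
  obtain ⟨c, hc, h⟩ := exists_pow_mul_norm_ker_le 0
  refine ⟨c * l2norm (fun x => (gauss x : ℂ)) + 1,
    by have := mul_nonneg hc.le (l2norm_nonneg fun x => (gauss x : ℂ)); linarith, fun z => ?_⟩
  have e1 : eLpNorm (ker z) 2 volume ≤
      ENNReal.ofReal c * eLpNorm (fun x => (gauss (x - z) : ℂ)) 2 volume := by
    refine eLpNorm_le_mul_eLpNorm_of_ae_le_mul (Filter.Eventually.of_forall fun x => ?_) 2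
    have := h z x
    rw [gauss_sub_comm, pow_zero, one_mul] at this
    rwa [Complex.norm_real, Real.norm_eq_abs, abs_of_pos (gauss_pos _)]
  have e2 : eLpNorm (fun x => (gauss (x - z) : ℂ)) 2 volume =
      eLpNorm (fun x => (gauss x : ℂ)) 2 (volume : Measure ℂ) :=
    eLpNorm_comp_measurePreserving (f := fun x => x - z) (g := fun x => (gauss x : ℂ))
      memLp_gauss.aestronglyMeasurable (measurePreserving_sub_right volume z)
  rw [e2] at e1
  have := ENNReal.toReal_mono
    (ENNReal.mul_ne_top ENNReal.ofReal_ne_top memLp_gauss.eLpNorm_ne_top) e1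
  rw [ENNReal.toReal_mul, ENNReal.toReal_ofReal hc.le] at this
  exact this.trans (le_add_of_nonneg_right zero_le_one)

lemma memLp_ker_right (z : ℂ) : MemLp (ker z) 2 volume := by
  refine (memLp_ker_left z).of_le (continuous_ker_right z).aestronglyMeasurable
    (Filter.Eventually.of_forall fun x => ?_)
  rw [norm_ker, norm_ker, norm_sub_rev]

/-- The inclusion of the Bargmann-Fock space in `L^∞` is bounded. -/
lemma exists_norm_le_l2norm : ∃ c : ℝ, 0 < c ∧ ∀ u ∈ Fock, ∀ z, ‖u z‖ ≤ c * l2norm u := by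
  obtain ⟨c, hc, h⟩ := l2norm_ker_right_le
  refine ⟨c, hc, fun u hu z => ?_⟩
  rw [← ker_reproduces hu z]
  exact (norm_integral_mul_le (memLp_ker_right z) hu.2).trans
    (mul_le_mul_of_nonneg_right (h z) (l2norm_nonneg u))

/-- `Π` is the integral operator with kernel `ker`. -/
lemma IsProj.eq_integral {g w : ℂ → ℂ} (h : IsProj g w) (z : ℂ) : w z = ∫ x, ker z x * g x := by
  obtain ⟨hg, hw, ho⟩ := h
  -- The orthogonality is tested against `ker · z`, whose conjugate is `ker z ·`.
  have h1 := ho _ (ker_mem_fock z)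
  simp only [conj_ker] at h1
  have h2 := integral_sub ((memLp_ker_right z).integrable_mul hg)
    ((memLp_ker_right z).integrable_mul hw.2)
  simp only [Pi.mul_apply, ← mul_sub] at h2
  simp only [mul_comm _ (ker _ _)] at h1
  rw [h1, ker_reproduces hw] at h2
  exact (sub_eq_zero.1 h2.symm).symm

lemma IsProj.unique {g w w' : ℂ → ℂ} (h : IsProj g w) (h' : IsProj g w') : w = w' := by
  funext z; rw [h.eq_integral, h'.eq_integral]

/-! ### The weight -/

lemma bracket_sq (z : ℂ) : bracket z ^ 2 = 1 + ‖z‖ ^ 2 := Real.sq_sqrt (by positivity)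

lemma one_le_bracket (z : ℂ) : 1 ≤ bracket z := Real.one_le_sqrt.2 (by nlinarith [norm_nonneg z])

lemma bracket_pos (z : ℂ) : 0 < bracket z := one_pos.trans_le (one_le_bracket z)

@[fun_prop]
lemma continuous_bracket : Continuous bracket := by unfold bracket; fun_prop

lemma norm_le_bracket (z : ℂ) : ‖z‖ ≤ bracket z := Real.le_sqrt_of_sq_le (by linarith)

lemma bracket_le_add (z w : ℂ) : bracket z ≤ bracket w + ‖z - w‖ := by
  have h1 := bracket_pos w
  refine Real.sqrt_le_iff.2 ⟨by positivity, ?_⟩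
  have h2 : ‖z‖ ≤ ‖w‖ + ‖z - w‖ := by simpa using norm_add_le w (z - w)
  have h3 := bracket_sq w
  have h4 := norm_le_bracket w
  nlinarith [norm_nonneg z, norm_nonneg w, norm_nonneg (z - w),
    mul_le_mul_of_nonneg_right h4 (norm_nonneg (z - w))]

/-- A Peetre-type inequality: moving a weight from `z` to `w` costs a factor `1 + ‖z - w‖`, which
the kernel absorbs. -/
lemma bracket_le_mul (z w : ℂ) : bracket z ≤ bracket w * (1 + ‖z - w‖) := by
  have := bracket_le_add z w
  nlinarith [one_le_bracket w, norm_nonneg (z - w)]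

lemma continuous_weighted {k : ℕ} {u : ℂ → ℂ} (hu : Continuous u) : Continuous (weighted k u) := by
  unfold weighted; fun_prop

lemma norm_weighted (k : ℕ) (u : ℂ → ℂ) (z : ℂ) : ‖weighted k u z‖ = bracket z ^ k * ‖u z‖ := by
  rw [weighted, norm_mul, Complex.norm_real, Real.norm_eq_abs,
    abs_of_pos (pow_pos (bracket_pos z) k)]

lemma weighted_zero (u : ℂ → ℂ) : weighted 0 u = u := by funext z; simp [weighted]

lemma norm_weighted_mono {j k : ℕ} (h : j ≤ k) (u : ℂ → ℂ) (z : ℂ) :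
    ‖weighted j u z‖ ≤ ‖weighted k u z‖ := by
  rw [norm_weighted, norm_weighted]
  exact mul_le_mul_of_nonneg_right (pow_le_pow_right₀ (one_le_bracket z) h) (norm_nonneg _)

lemma l2norm_mono {f g : ℂ → ℂ} (hg : MemLp g 2 volume) (h : ∀ z, ‖f z‖ ≤ ‖g z‖) :
    l2norm f ≤ l2norm g :=
  ENNReal.toReal_mono hg.eLpNorm_ne_top (eLpNorm_mono h)

lemma l2norm_le_mul {f g : ℂ → ℂ} (hg : MemLp g 2 volume) {c : ℝ} (hc : 0 ≤ c)
    (h : ∀ z, ‖f z‖ ≤ c * ‖g z‖) : l2norm f ≤ c * l2norm g := by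
  have := eLpNorm_le_mul_eLpNorm_of_ae_le_mul (Filter.Eventually.of_forall h) 2
    (μ := (volume : Measure ℂ))
  have := ENNReal.toReal_mono (ENNReal.mul_ne_top ENNReal.ofReal_ne_top hg.eLpNorm_ne_top) this
  rwa [ENNReal.toReal_mul, ENNReal.toReal_ofReal hc] at this

lemma memLp_weighted_mono {j k : ℕ} (h : j ≤ k) {u : ℂ → ℂ} (hc : Continuous u)
    (hu : MemLp (weighted k u) 2 volume) : MemLp (weighted j u) 2 volume :=
  hu.mono (continuous_weighted hc).aestronglyMeasurable
    (Filter.Eventually.of_forall (norm_weighted_mono h u))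

/-! ### Embeddings of the weighted spaces in `L²` and in the bounded continuous functions -/

namespace L2E

variable {k : ℕ}

lemma l2norm_weighted_le_norm {j : ℕ} (h : j ≤ k) (u : L2E k) : l2norm (weighted j u) ≤ ‖u‖ := by
  rw [norm_eq]
  exact l2norm_mono u.memLp (norm_weighted_mono h _)

lemma l2norm_le_norm (u : L2E k) : l2norm u ≤ ‖u‖ := by
  simpa only [weighted_zero] using u.l2norm_weighted_le_norm (Nat.zero_le k)

lemma memLp_weighted {j : ℕ} (h : j ≤ k) (u : L2E k) : MemLp (weighted j u) 2 volume :=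
  memLp_weighted_mono h u.continuous u.memLp

@[simp] lemma add_apply (u v : L2E k) (z : ℂ) : (u + v) z = u z + v z := rfl
@[simp] lemma smul_apply (c : ℂ) (u : L2E k) (z : ℂ) : (c • u) z = c * u z := rfl

/-- The isometric embedding `u ↦ ⟨z⟩^k u` in `L²`. -/
def toL2ᵢ (k : ℕ) : L2E k →ₗᵢ[ℂ] Lp ℂ 2 (volume : Measure ℂ) := ⟨toL2 k, fun _ => rfl⟩

lemma coeFn_toL2ᵢ (u : L2E k) : toL2ᵢ k u =ᵐ[volume] weighted k u := u.memLp.coeFn_toLp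

/-- The constant of the embedding in `L^∞`. -/
def supConst : ℝ := exists_norm_le_l2norm.choose

lemma supConst_pos : 0 < supConst := exists_norm_le_l2norm.choose_spec.1

lemma norm_apply_le_l2norm (u : L2E k) (z : ℂ) : ‖u z‖ ≤ supConst * l2norm u :=
  exists_norm_le_l2norm.choose_spec.2 u u.mem_fock z

lemma norm_apply_le (u : L2E k) (z : ℂ) : ‖u z‖ ≤ supConst * ‖u‖ :=
  (u.norm_apply_le_l2norm z).trans
    (mul_le_mul_of_nonneg_left u.l2norm_le_norm supConst_pos.le)

/-- The embedding of `L^{2,k}_E` in the bounded continuous functions. -/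
def toBCF (k : ℕ) : L2E k →L[ℂ] (ℂ →ᵇ ℂ) :=
  LinearMap.mkContinuous
    { toFun := fun u => BoundedContinuousFunction.ofNormedAddCommGroup u u.continuous _ u.norm_apply_le
      map_add' := fun _ _ => by ext; rfl
      map_smul' := fun _ _ => by ext; rfl } supConst
    fun u => BoundedContinuousFunction.norm_ofNormedAddCommGroup_le _
      (mul_nonneg supConst_pos.le (norm_nonneg u)) u.norm_apply_le

lemma norm_toBCF_le (u : L2E k) : ‖toBCF k u‖ ≤ supConst * l2norm u :=
  (BoundedContinuousFunction.norm_le (mul_nonneg supConst_pos.le (l2norm_nonneg _))).2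
    u.norm_apply_le_l2norm

/-! ### Completeness -/

/-- The factor `exp (|z|²/2)` is bounded on compact sets, so uniform convergence of the `u n` gives
locally uniform convergence of their entire parts, and the limit is entire. -/
lemma exists_entire_of_tendsto {u : ℕ → L2E k} {b : ℂ →ᵇ ℂ}
    (h : Filter.Tendsto (fun n => toBCF k (u n)) Filter.atTop (nhds b)) :
    ∃ f : ℂ → ℂ, Differentiable ℂ f ∧ ∀ z, b z = (Real.exp (-(‖z‖ ^ 2) / 2) : ℂ) * f z := by
  have e1 : ∀ z : ℂ, (Real.exp (-(‖z‖ ^ 2) / 2) : ℂ) * (Real.exp (‖z‖ ^ 2 / 2) : ℂ) = 1 := by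
    intro z
    rw [← Complex.ofReal_mul, ← Real.exp_add]
    simp [neg_div]
  refine ⟨fun z => (Real.exp (‖z‖ ^ 2 / 2) : ℂ) * b z, ?_, fun z => ?_⟩
  swap
  · rw [← mul_assoc, e1, one_mul]
  rw [BoundedContinuousFunction.tendsto_iff_tendstoUniformly, Metric.tendstoUniformly_iff] at h
  rw [← differentiableOn_univ]
  refine TendstoLocallyUniformlyOn.differentiableOn (φ := Filter.atTop)
    (F := fun n z => (Real.exp (‖z‖ ^ 2 / 2) : ℂ) * u n z) ?_
    (Filter.Eventually.of_forall fun n => ?_) isOpen_univ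
  · rw [tendstoLocallyUniformlyOn_univ, tendstoLocallyUniformly_iff_forall_isCompact]
    intro K hK
    have hcont : Continuous fun z : ℂ => Real.exp (‖z‖ ^ 2 / 2) := by fun_prop
    obtain ⟨B, hB⟩ := hK.exists_bound_of_continuousOn hcont.continuousOn
    rw [Metric.tendstoUniformlyOn_iff]
    intro ε hε
    filter_upwards [h (ε / (|B| + 1)) (by positivity)] with n hn z hz
    have h1 := hn z
    have h2 := hB z hz
    rw [dist_eq_norm] at h1 ⊢
    rw [← mul_sub, norm_mul, Complex.norm_real]
    have h3 : ‖Real.exp (‖z‖ ^ 2 / 2)‖ ≤ |B| + 1 := h2.trans (by linarith [le_abs_self B])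
    have h4 : (0 : ℝ) < |B| + 1 := by positivity
    calc ‖Real.exp (‖z‖ ^ 2 / 2)‖ * ‖b z - u n z‖ ≤ (|B| + 1) * ‖b z - u n z‖ := by gcongr
      _ < (|B| + 1) * (ε / (|B| + 1)) := by gcongr; exact h1
      _ = ε := by field_simp
  · obtain ⟨⟨f, hf, huf⟩, -⟩ := (u n).mem_fock
    have : (fun z => (Real.exp (‖z‖ ^ 2 / 2) : ℂ) * u n z) = f := by
      funext z
      rw [huf z]
      linear_combination f z * e1 z
    rw [this]
    exact hf.differentiableOn

/-- A Cauchy sequence converges both in `L²` with weight and uniformly. An almost everywhere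
convergent subsequence identifies the two limits, and the uniform one has the required holomorphic
form. -/
instance : CompleteSpace (L2E k) := by
  refine Metric.complete_of_cauchySeq_tendsto fun u hu => ?_
  obtain ⟨g, hg⟩ := cauchySeq_tendsto_of_complete ((toL2ᵢ k).isometry.uniformContinuous.comp_cauchySeq hu)
  obtain ⟨b, hb⟩ := cauchySeq_tendsto_of_complete ((toBCF k).uniformContinuous.comp_cauchySeq hu)
  obtain ⟨ns, hns, hae⟩ := (tendstoInMeasure_of_tendsto_Lp hg).exists_seq_tendsto_ae
  have hpt : ∀ z, Filter.Tendsto (fun n => u n z) Filter.atTop (nhds (b z)) := fun z =>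
    (BoundedContinuousFunction.tendsto_iff_tendstoUniformly.1 hb).tendsto_at z
  have hgb : g =ᵐ[volume] weighted k b := by
    have hall : ∀ᵐ z ∂(volume : Measure ℂ), ∀ n, toL2ᵢ k (u n) z = weighted k (u n) z :=
      ae_all_iff.2 fun n => (u n).coeFn_toL2ᵢ
    filter_upwards [hae, hall] with z h1 h2
    refine tendsto_nhds_unique h1 ?_
    have h3 : Filter.Tendsto (fun i => weighted k (u (ns i)) z) Filter.atTop
        (nhds (weighted k b z)) :=
      ((hpt z).comp hns.tendsto_atTop).const_mul _
    exact h3.congr fun i => (h2 (ns i)).symm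
  have hbk : MemLp (weighted k b) 2 volume := (memLp_congr_ae hgb).1 (Lp.memLp g)
  have hb0 : MemLp b 2 volume := by
    have := memLp_weighted_mono (Nat.zero_le k) b.continuous hbk
    rwa [weighted_zero] at this
  let w : L2E k := ⟨b, ⟨exists_entire_of_tendsto hb, hb0⟩, hbk⟩
  have hw : toL2ᵢ k w = g := by
    refine Lp.ext ?_
    exact (w.coeFn_toL2ᵢ).trans hgb.symm
  refine ⟨w, (toL2ᵢ k).isometry.isEmbedding.tendsto_nhds_iff.2 ?_⟩
  rw [hw]; exact hg

end L2E

/-! ### The projection -/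

/-- Completeness makes the Bargmann-Fock space closed in `L²`, so the Hilbert space projection
exists. -/
lemma exists_isProj {g : ℂ → ℂ} (hg : MemLp g 2 volume) : ∃ w, IsProj g w := by
  let S : Submodule ℂ (Lp ℂ 2 (volume : Measure ℂ)) := (L2E.toL2ᵢ 0).toLinearMap.range
  have hS : IsClosed (S : Set (Lp ℂ 2 (volume : Measure ℂ))) := by
    convert (L2E.toL2ᵢ 0).isometry.isClosedEmbedding.isClosed_range
    ext; simp [S]
  have : CompleteSpace S := hS.completeSpace_coe
  obtain ⟨w, hw⟩ := (S.starProjection_apply_mem (hg.toLp g) : _ ∈ (L2E.toL2ᵢ 0).toLinearMap.range)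
  refine ⟨w, hg, w.mem_fock, fun h hh => ?_⟩
  let h' : L2E 0 := ⟨h, hh, by rw [weighted_zero]; exact hh.2⟩
  have h1 := S.starProjection_inner_eq_zero (hg.toLp g) (L2E.toL2ᵢ 0 h') ⟨h', rfl⟩
  rw [← inner_conj_symm, L2.inner_def, ← hw] at h1
  rw [map_eq_zero] at h1
  rw [← h1]
  refine integral_congr_ae ?_
  filter_upwards [hg.coeFn_toLp, w.coeFn_toL2ᵢ, h'.coeFn_toL2ᵢ,
    Lp.coeFn_sub (hg.toLp g) (L2E.toL2ᵢ 0 w)] with z e1 e2 e3 e4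
  change _ = inner ℂ (L2E.toL2ᵢ 0 h' z) ((hg.toLp g - L2E.toL2ᵢ 0 w : Lp ℂ 2 volume) z)
  rw [e4, e3, Pi.sub_apply, e1, e2, weighted_zero, weighted_zero, RCLike.inner_apply]
  rfl

/-- The operator with kernel `ker`. -/
def kerInt (g : ℂ → ℂ) (z : ℂ) : ℂ := ∫ x, ker z x * g x

lemma isProj_kerInt {g : ℂ → ℂ} (hg : MemLp g 2 volume) : IsProj g (kerInt g) := by
  obtain ⟨w, hw⟩ := exists_isProj hg
  have : kerInt g = w := funext fun z => (hw.eq_integral z).symm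
  rwa [this]

lemma kerInt_add {f g : ℂ → ℂ} (hf : MemLp f 2 volume) (hg : MemLp g 2 volume) :
    kerInt (f + g) = kerInt f + kerInt g := by
  funext z
  have := integral_add ((memLp_ker_right z).integrable_mul hf) ((memLp_ker_right z).integrable_mul hg)
  simpa only [Pi.mul_apply, Pi.add_apply, kerInt, mul_add] using this

lemma kerInt_smul (c : ℂ) (g : ℂ → ℂ) : kerInt (c • g) = c • kerInt g := by
  funext z
  simp only [kerInt, Pi.smul_apply, smul_eq_mul, mul_left_comm _ c, integral_const_mul]

/-- Exchange `⟨z⟩^k` for `⟨w⟩^k (1 + ‖z - w‖)^k`, absorb the last factor in the kernel and apply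
Schur's test. -/
lemma exists_l2norm_weighted_kerInt_le (k : ℕ) : ∃ c : ℝ, 0 ≤ c ∧ ∀ g : ℂ → ℂ, Continuous g →
    MemLp (weighted k g) 2 volume → MemLp (weighted k (kerInt g)) 2 volume ∧
      l2norm (weighted k (kerInt g)) ≤ c * l2norm (weighted k g) := by
  obtain ⟨c, hc, h⟩ := exists_pow_mul_norm_ker_le k
  refine ⟨c * gaussMass, mul_nonneg hc.le gaussMass_nonneg, fun g hg hgk => ?_⟩
  have hg2 : MemLp g 2 volume := by
    have := memLp_weighted_mono (Nat.zero_le k) hg hgk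
    rwa [weighted_zero] at this
  refine memLp_and_l2norm_le_of_gauss (continuous_weighted hg)
    (continuous_weighted (continuous_of_mem_fock (isProj_kerInt hg2).2.1)) hgk hc.le fun z => ?_
  rw [weighted, kerInt, ← integral_const_mul, ← lintegral_const_mul' _ _ ENNReal.ofReal_ne_top]
  refine (enorm_integral_le_lintegral_enorm _).trans (lintegral_mono fun w => ?_)
  rw [← ofReal_norm, ← ofReal_norm, ← ENNReal.ofReal_mul (gauss_pos _).le,
    ← ENNReal.ofReal_mul hc.le]
  refine ENNReal.ofReal_le_ofReal ?_
  rw [norm_weighted, norm_mul, norm_mul, Complex.norm_real, Real.norm_eq_abs,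
    abs_of_pos (pow_pos (bracket_pos z) k)]
  calc bracket z ^ k * (‖ker z w‖ * ‖g w‖)
      ≤ (bracket w * (1 + ‖z - w‖)) ^ k * (‖ker z w‖ * ‖g w‖) := by
        gcongr
        · exact (bracket_pos z).le
        · exact bracket_le_mul z w
    _ = ((1 + ‖z - w‖) ^ k * ‖ker z w‖) * (bracket w ^ k * ‖g w‖) := by rw [mul_pow]; ring
    _ ≤ (c * gauss (z - w)) * (bracket w ^ k * ‖g w‖) := by
        have := bracket_pos w
        exact mul_le_mul_of_nonneg_right (h z w) (by positivity)
    _ = _ := by ring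

/-! ### Toeplitz operators -/

namespace L2E

variable {k : ℕ}

lemma weighted_bcf_mul (a : ℂ →ᵇ ℂ) (u : ℂ → ℂ) :
    weighted k (fun z => a z * u z) = fun z => a z * weighted k u z := by
  funext z; simp only [weighted]; ring

lemma memLp_weighted_bcf_mul {j : ℕ} (h : j ≤ k) (a : ℂ →ᵇ ℂ) (u : L2E k) :
    MemLp (weighted j fun z => a z * u z) 2 volume := by
  rw [weighted_bcf_mul]
  refine (u.memLp_weighted h).of_le_mul (c := ‖a‖) ?_ (Filter.Eventually.of_forall fun z => ?_)
  · exact (a.continuous.mul (continuous_weighted u.continuous)).aestronglyMeasurable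
  · rw [norm_mul]
    exact mul_le_mul_of_nonneg_right (a.norm_coe_le_norm z) (norm_nonneg _)

lemma l2norm_weighted_bcf_mul_le {j : ℕ} (h : j ≤ k) (a : ℂ →ᵇ ℂ) (u : L2E k) :
    l2norm (weighted j fun z => a z * u z) ≤ ‖a‖ * l2norm (weighted j u) := by
  rw [weighted_bcf_mul]
  refine l2norm_le_mul (u.memLp_weighted h) (norm_nonneg a) fun z => ?_
  rw [norm_mul]
  exact mul_le_mul_of_nonneg_right (a.norm_coe_le_norm z) (norm_nonneg _)

lemma continuous_bcf_mul (a : ℂ →ᵇ ℂ) (u : L2E k) : Continuous fun z => a z * u z :=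
  a.continuous.mul u.continuous

lemma memLp_bcf_mul (a : ℂ →ᵇ ℂ) (u : L2E k) : MemLp (fun z => a z * u z) 2 volume := by
  simpa only [weighted_zero] using memLp_weighted_bcf_mul (Nat.zero_le k) a u

/-- The function `Π(a u)`. -/
def projMul (a : ℂ →ᵇ ℂ) (u : L2E k) : L2E k :=
  ⟨kerInt fun z => a z * u z, (isProj_kerInt (memLp_bcf_mul a u)).2.1,
    ((exists_l2norm_weighted_kerInt_le k).choose_spec.2 _ (continuous_bcf_mul a u)
      (memLp_weighted_bcf_mul le_rfl a u)).1⟩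

lemma projMul_apply (a : ℂ →ᵇ ℂ) (u : L2E k) (z : ℂ) :
    projMul a u z = kerInt (fun z => a z * u z) z := rfl

/-- The Toeplitz operator `(a, u) ↦ Π(a u)`. -/
def toeplitz (k : ℕ) : (ℂ →ᵇ ℂ) →L[ℂ] L2E k →L[ℂ] L2E k :=
  LinearMap.mkContinuous₂
    (LinearMap.mk₂ ℂ projMul
      (fun a b u => ext fun z => by
        rw [add_apply, projMul_apply, projMul_apply, projMul_apply, ← Pi.add_apply,
          ← kerInt_add (memLp_bcf_mul a u) (memLp_bcf_mul b u)]
        congr 1; funext z; simp [add_mul])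
      (fun c a u => ext fun z => by
        rw [smul_apply, projMul_apply, projMul_apply, ← smul_eq_mul, ← Pi.smul_apply,
          ← kerInt_smul]
        congr 1; funext z; simp [mul_assoc])
      (fun a u v => ext fun z => by
        rw [add_apply, projMul_apply, projMul_apply, projMul_apply, ← Pi.add_apply,
          ← kerInt_add (memLp_bcf_mul a u) (memLp_bcf_mul a v)]
        congr 1; funext z; simp [mul_add])
      (fun c a u => ext fun z => by
        rw [smul_apply, projMul_apply, projMul_apply, ← smul_eq_mul, ← Pi.smul_apply,
          ← kerInt_smul]
        congr 1; funext z; simp [mul_left_comm]))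
    (exists_l2norm_weighted_kerInt_le k).choose
    (fun a u => by
      rw [LinearMap.mk₂_apply, norm_eq, norm_eq u, mul_assoc]
      exact ((exists_l2norm_weighted_kerInt_le k).choose_spec.2 _ (continuous_bcf_mul a u)
        (memLp_weighted_bcf_mul le_rfl a u)).2.trans
        (mul_le_mul_of_nonneg_left (l2norm_weighted_bcf_mul_le le_rfl a u)
          (exists_l2norm_weighted_kerInt_le k).choose_spec.1))

lemma toeplitz_apply (a : ℂ →ᵇ ℂ) (u : L2E k) (z : ℂ) :
    toeplitz k a u z = kerInt (fun z => a z * u z) z := rfl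

lemma isProj_toeplitz (a : ℂ →ᵇ ℂ) (u : L2E k) :
    IsProj (fun z => a z * u z) (toeplitz k a u) :=
  isProj_kerInt (memLp_bcf_mul a u)

end L2E

/-! ### Elementary inequalities for the weight -/

lemma bracket_pow_add_le (i j : ℕ) (z w : ℂ) :
    bracket w ^ (i + j) ≤ (1 + ‖z - w‖) ^ i * (bracket z ^ i * bracket w ^ j) := by
  have h1 := bracket_le_mul w z
  rw [norm_sub_rev] at h1
  have h2 := bracket_pos w
  have h3 := bracket_pos z
  calc bracket w ^ (i + j) = bracket w ^ i * bracket w ^ j := pow_add _ _ _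
    _ ≤ (bracket z * (1 + ‖z - w‖)) ^ i * bracket w ^ j := by gcongr
    _ = _ := by rw [mul_pow]; ring

lemma abs_bracket_sub_le (z w : ℂ) : |bracket z - bracket w| ≤ ‖z - w‖ := by
  have h1 := bracket_le_add z w
  have h2 := bracket_le_add w z
  rw [norm_sub_rev] at h2
  exact abs_sub_le_iff.2 ⟨by linarith, by linarith⟩

/-- The weight is 1-Lipschitz, so the difference loses one power. The exponent `3 * k + 3` collects
`2 * k + 2` from the mean value bound and `k + 1` from moving weights from `w` to `z`. -/
lemma abs_bracket_pow_sub_le (k : ℕ) (z w : ℂ) :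
    |bracket z ^ (2 * (k + 1)) - bracket w ^ (2 * (k + 1))| ≤
      (2 * (k + 1)) * ((1 + ‖z - w‖) ^ (3 * k + 3) * (bracket z ^ (k + 1) * bracket w ^ k)) := by
  have hz := bracket_pos z
  have hw := bracket_pos w
  have hd := norm_nonneg (z - w)
  have h1 := abs_pow_sub_pow_le (bracket z) (bracket w) (2 * (k + 1))
  rw [abs_of_pos hz, abs_of_pos hw, show 2 * (k + 1) - 1 = (k + 1) + k by omega] at h1
  have hM : max (bracket z) (bracket w) ≤ bracket w * (1 + ‖z - w‖) :=
    max_le (bracket_le_mul z w) (le_mul_of_one_le_right hw.le (by linarith))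
  have h3 : |bracket z - bracket w| ≤ 1 + ‖z - w‖ := (abs_bracket_sub_le z w).trans (by linarith)
  refine h1.trans ?_
  calc |bracket z - bracket w| * ((2 * (k + 1) : ℕ) : ℝ) * max (bracket z) (bracket w) ^ (k + 1 + k)
      ≤ (1 + ‖z - w‖) * ((2 * (k + 1) : ℕ) : ℝ) * (bracket w * (1 + ‖z - w‖)) ^ (k + 1 + k) := by
        gcongr
    _ = (2 * (k + 1)) * ((1 + ‖z - w‖) ^ (2 * k + 2) * bracket w ^ (k + 1 + k)) := by
        rw [mul_pow]; push_cast; ring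
    _ ≤ (2 * (k + 1)) * ((1 + ‖z - w‖) ^ (2 * k + 2) *
          ((1 + ‖z - w‖) ^ (k + 1) * (bracket z ^ (k + 1) * bracket w ^ k))) := by
        gcongr; exact bracket_pow_add_le (k + 1) k z w
    _ = _ := by ring

/-- Second-order Taylor bound for a power, by induction: multiplying the remainder by `X` leaves the
extra term `(n + 2) Y ^ (n + 1) (X - Y) ^ 2`. -/
lemma abs_pow_sub_pow_sub_le {X Y M : ℝ} (hX : 0 ≤ X) (hY : 0 ≤ Y) (hXM : X ≤ M) (hYM : Y ≤ M)
    (n : ℕ) : |X ^ (n + 2) - Y ^ (n + 2) - (n + 2) * Y ^ (n + 1) * (X - Y)| ≤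
      (n + 2) ^ 2 * M ^ n * (X - Y) ^ 2 := by
  have hM : 0 ≤ M := hX.trans hXM
  induction n with
  | zero =>
    have : X ^ (0 + 2) - Y ^ (0 + 2) - ((0 : ℕ) + 2) * Y ^ (0 + 1) * (X - Y) = (X - Y) ^ 2 := by
      push_cast; ring
    rw [this, abs_of_nonneg (sq_nonneg _)]
    push_cast
    nlinarith [sq_nonneg (X - Y)]
  | succ n ih =>
    have e : X ^ (n + 1 + 2) - Y ^ (n + 1 + 2) - ((n + 1 : ℕ) + 2) * Y ^ (n + 1 + 1) * (X - Y) =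
        X * (X ^ (n + 2) - Y ^ (n + 2) - (n + 2) * Y ^ (n + 1) * (X - Y)) +
          (n + 2) * Y ^ (n + 1) * (X - Y) ^ 2 := by
      push_cast; ring
    rw [e]
    refine (abs_add_le _ _).trans ?_
    rw [abs_mul, abs_of_nonneg hX, abs_of_nonneg (by positivity : 0 ≤ (n + 2) * Y ^ (n + 1) * (X - Y) ^ 2)]
    calc X * |X ^ (n + 2) - Y ^ (n + 2) - (n + 2) * Y ^ (n + 1) * (X - Y)| +
          (n + 2) * Y ^ (n + 1) * (X - Y) ^ 2
        ≤ M * ((n + 2) ^ 2 * M ^ n * (X - Y) ^ 2) + (n + 2) * M ^ (n + 1) * (X - Y) ^ 2 := by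
          gcongr
      _ = ((n + 2) ^ 2 + (n + 2)) * (M ^ (n + 1) * (X - Y) ^ 2) := by ring
      _ ≤ (((n + 1 : ℕ) : ℝ) + 2) ^ 2 * (M ^ (n + 1) * (X - Y) ^ 2) := by
          gcongr; push_cast; nlinarith
      _ = _ := by ring

/-- The first-order part of `|z|² - |w|²` at `w`. -/
def linPart (z w : ℂ) : ℝ := bracket z ^ 2 - bracket w ^ 2 - ‖z - w‖ ^ 2

lemma linPart_eq (z w : ℂ) : (linPart z w : ℂ) =
    (starRingEnd ℂ) w * (z - w) + w * (starRingEnd ℂ) (z - w) := by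
  have n2 : ∀ y : ℂ, ((‖y‖ ^ 2 : ℝ) : ℂ) = y * (starRingEnd ℂ) y := fun y => by
    rw [Complex.mul_conj, Complex.normSq_eq_norm_sq]
  rw [linPart, bracket_sq, bracket_sq]
  simp only [Complex.ofReal_sub, Complex.ofReal_add, n2, map_sub]
  ring

/-- Taylor's bound in the variable `⟨z⟩²`. The constant `5` is `4`, from `(⟨z⟩² - ⟨w⟩²)²`, plus `1`,
from the term `‖z - w‖²` left out of `linPart`. -/
lemma abs_bracket_pow_sub_linPart_le (n : ℕ) (z w : ℂ) :
    |bracket z ^ (2 * (n + 2)) - bracket w ^ (2 * (n + 2)) -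
      (n + 2) * (bracket w ^ (2 * (n + 1)) * linPart z w)| ≤
      (5 * (n + 2) ^ 2) * ((1 + ‖z - w‖) ^ (3 * n + 5) * (bracket z ^ (n + 1) * bracket w ^ (n + 1))) := by
  have hz := bracket_pos z
  have hw := bracket_pos w
  have hd := norm_nonneg (z - w)
  set d := ‖z - w‖ with hdef
  set x := bracket z
  set y := bracket w
  have hxM : x ≤ y * (1 + d) := bracket_le_mul z w
  have hyM : y ≤ y * (1 + d) := le_mul_of_one_le_right hw.le (by linarith)
  have h1 := abs_pow_sub_pow_sub_le (X := x ^ 2) (Y := y ^ 2) (M := (y * (1 + d)) ^ 2)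
    (by positivity) (by positivity) (by gcongr) (by gcongr) n
  have h2 : (x ^ 2 - y ^ 2) ^ 2 ≤ (1 + d) ^ 2 * (2 * (y * (1 + d))) ^ 2 := by
    have e : (x ^ 2 - y ^ 2) ^ 2 = |x - y| ^ 2 * (x + y) ^ 2 := by rw [sq_abs]; ring
    rw [e]
    have : |x - y| ≤ 1 + d := (abs_bracket_sub_le z w).trans (by linarith)
    gcongr
    linarith
  have h3 : y ^ (2 * n + 2) ≤ (1 + d) ^ (n + 1) * (x ^ (n + 1) * y ^ (n + 1)) := by
    have := bracket_pow_add_le (n + 1) (n + 1) z w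
    rwa [show n + 1 + (n + 1) = 2 * n + 2 by ring] at this
  have e1 : x ^ (2 * (n + 2)) - y ^ (2 * (n + 2)) - (n + 2) * (y ^ (2 * (n + 1)) * linPart z w) =
      ((x ^ 2) ^ (n + 2) - (y ^ 2) ^ (n + 2) - (n + 2) * (y ^ 2) ^ (n + 1) * (x ^ 2 - y ^ 2)) +
        (n + 2) * (y ^ (2 * n + 2) * d ^ 2) := by
    rw [linPart]; ring
  rw [e1]
  refine (abs_add_le _ _).trans ?_
  rw [abs_of_nonneg (by positivity : 0 ≤ (n + 2) * (y ^ (2 * n + 2) * d ^ 2))]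
  have h4 : (n + 2 : ℝ) * (y ^ (2 * n + 2) * d ^ 2) ≤
      (n + 2) ^ 2 * (y ^ (2 * n + 2) * (1 + d) ^ (2 * n + 4)) := by
    have a1 : d ^ 2 ≤ (1 + d) ^ (2 * n + 4) :=
      (pow_le_pow_left₀ hd (by linarith) 2).trans (pow_le_pow_right₀ (by linarith) (by omega))
    have a2 : (n + 2 : ℝ) ≤ (n + 2) ^ 2 := by nlinarith [(Nat.cast_nonneg n : (0 : ℝ) ≤ n)]
    gcongr
  calc _ ≤ (n + 2) ^ 2 * ((y * (1 + d)) ^ 2) ^ n * ((1 + d) ^ 2 * (2 * (y * (1 + d))) ^ 2) +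
        (n + 2) ^ 2 * (y ^ (2 * n + 2) * (1 + d) ^ (2 * n + 4)) := by
        refine add_le_add (h1.trans ?_) h4
        gcongr
    _ = (5 * (n + 2) ^ 2) * ((1 + d) ^ (2 * n + 4) * y ^ (2 * n + 2)) := by
        rw [← pow_mul, mul_pow, mul_pow, mul_pow]; ring
    _ ≤ (5 * (n + 2) ^ 2) * ((1 + d) ^ (2 * n + 4) *
          ((1 + d) ^ (n + 1) * (x ^ (n + 1) * y ^ (n + 1)))) := by gcongr
    _ = _ := by ring

/-! ### Sesquilinear forms with kernel `ker` -/

namespace L2E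

variable {k : ℕ}

/-- The integrand of the form `⟨u, K_Φ (a u)⟩`, where `K_Φ` has the kernel `ker · Φ`. -/
def formFun (Φ : ℂ × ℂ → ℂ) (a : ℂ →ᵇ ℂ) (u : L2E k) (p : ℂ × ℂ) : ℂ :=
  ker p.1 p.2 * (Φ p * (a p.2 * u p.2 * (starRingEnd ℂ) (u p.1)))

/-- The form `⟨u, K_Φ (a u)⟩`, where `K_Φ` has the kernel `ker · Φ`. -/
def form (Φ : ℂ × ℂ → ℂ) (a : ℂ →ᵇ ℂ) (u : L2E k) : ℂ :=
  ∫ p, formFun Φ a u p ∂(volume : Measure ℂ).prod volume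

/-- The powers of `1 + ‖z - w‖` go into the kernel, `⟨z⟩^i` goes to `u z` and `⟨w⟩^j` to `u w`;
Schur's test does the rest. The constant depends on `n` alone. -/
lemma exists_form_le (n : ℕ) : ∃ c : ℝ, 0 ≤ c ∧ ∀ {k : ℕ} (i j : ℕ), i ≤ k → j ≤ k →
    ∀ (Φ : ℂ × ℂ → ℂ), Continuous Φ → ∀ m : ℝ, 0 ≤ m →
    (∀ z w, ‖Φ (z, w)‖ ≤ m * ((1 + ‖z - w‖) ^ n * (bracket z ^ i * bracket w ^ j))) →
    ∀ (a : ℂ →ᵇ ℂ) (u : L2E k), Integrable (formFun Φ a u) ((volume : Measure ℂ).prod volume) ∧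
      ‖form Φ a u‖ ≤ m * c * (‖a‖ * (l2norm (weighted i u) * l2norm (weighted j u))) := by
  obtain ⟨c, hc, h⟩ := exists_pow_mul_norm_ker_le n
  refine ⟨c * gaussMass, mul_nonneg hc.le gaussMass_nonneg, ?_⟩
  intro k i j hi hj Φ hΦ m hm hb a u
  have hu := u.continuous
  have ha := a.continuous
  have hcont : Continuous (formFun Φ a u) := by
    unfold formFun
    have c1 := continuous_ker
    fun_prop
  have hle : ∀ z w, ‖formFun Φ a u (z, w)‖ ≤ (m * c) * gauss (z - w) *
      (‖weighted i u z‖ * ‖weighted j (fun w => a w * u w) w‖) := by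
    intro z w
    have := bracket_pos z
    have := bracket_pos w
    rw [norm_weighted, norm_weighted, formFun, norm_mul, norm_mul, norm_mul (_ * _) _,
      RCLike.norm_conj]
    calc ‖ker z w‖ * (‖Φ (z, w)‖ * (‖a w * u w‖ * ‖u z‖))
        ≤ ‖ker z w‖ * ((m * ((1 + ‖z - w‖) ^ n * (bracket z ^ i * bracket w ^ j))) *
          (‖a w * u w‖ * ‖u z‖)) := by gcongr; exact hb z w
      _ = m * ((1 + ‖z - w‖) ^ n * ‖ker z w‖) *
          ((bracket z ^ i * ‖u z‖) * (bracket w ^ j * ‖a w * u w‖)) := by ring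
      _ ≤ m * (c * gauss (z - w)) *
          ((bracket z ^ i * ‖u z‖) * (bracket w ^ j * ‖a w * u w‖)) := by
          refine mul_le_mul_of_nonneg_right (mul_le_mul_of_nonneg_left (h z w) hm) (by positivity)
      _ = _ := by ring
  obtain ⟨h1, h2⟩ := integrable_and_norm_integral_le_of_gauss (continuous_weighted hu)
    (continuous_weighted (continuous_bcf_mul a u)) (u.memLp_weighted hi)
    (memLp_weighted_bcf_mul hj a u) (mul_nonneg hm hc.le) hcont hle
  refine ⟨h1, h2.trans ?_⟩
  have h3 := l2norm_weighted_bcf_mul_le hj a u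
  calc m * c * gaussMass * (l2norm (weighted i u) * l2norm (weighted j fun w => a w * u w))
      ≤ m * c * gaussMass * (l2norm (weighted i u) * (‖a‖ * l2norm (weighted j u))) := by
        have := gaussMass_nonneg
        have := l2norm_nonneg (weighted i u)
        gcongr
    _ = _ := by ring

lemma form_add {Φ Ψ : ℂ × ℂ → ℂ} {a : ℂ →ᵇ ℂ} {u : L2E k}
    (hΦ : Integrable (formFun Φ a u) ((volume : Measure ℂ).prod volume))
    (hΨ : Integrable (formFun Ψ a u) ((volume : Measure ℂ).prod volume)) :
    form (fun p => Φ p + Ψ p) a u = form Φ a u + form Ψ a u := by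
  rw [form, form, form, ← integral_add hΦ hΨ]
  refine integral_congr_ae (Filter.Eventually.of_forall fun p => ?_)
  simp only [formFun]; ring

lemma form_sub {Φ Ψ : ℂ × ℂ → ℂ} {a : ℂ →ᵇ ℂ} {u : L2E k}
    (hΦ : Integrable (formFun Φ a u) ((volume : Measure ℂ).prod volume))
    (hΨ : Integrable (formFun Ψ a u) ((volume : Measure ℂ).prod volume)) :
    form (fun p => Φ p - Ψ p) a u = form Φ a u - form Ψ a u := by
  rw [form, form, form, ← integral_sub hΦ hΨ]
  refine integral_congr_ae (Filter.Eventually.of_forall fun p => ?_)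
  simp only [formFun]; ring

lemma form_const_mul (c : ℂ) (Φ : ℂ × ℂ → ℂ) (a : ℂ →ᵇ ℂ) (u : L2E k) :
    form (fun p => c * Φ p) a u = c * form Φ a u := by
  rw [form, form, ← integral_const_mul]
  refine integral_congr_ae (Filter.Eventually.of_forall fun p => ?_)
  simp only [formFun]; ring

lemma formFun_inner (ρ q : ℂ → ℂ) (a : ℂ →ᵇ ℂ) (u : L2E k) (w : ℂ) :
    ∫ z, formFun (fun p => ρ p.2 * q (p.1 - p.2)) a u (z, w) = ρ w * (a w * u w) *
      (starRingEnd ℂ) (∫ z, ker w z * ((starRingEnd ℂ) (q (z - w)) * u z)) := by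
  rw [← integral_conj, ← integral_const_mul]
  refine integral_congr_ae (Filter.Eventually.of_forall fun z => ?_)
  simp only [formFun, map_mul, conj_ker, Complex.conj_conj]
  ring

/-- Integrating in `z` first leaves an inner integral that the reproducing formulas evaluate. -/
lemma form_eq_integral {ρ q : ℂ → ℂ} {a : ℂ →ᵇ ℂ} {u : L2E k}
    (h : Integrable (formFun (fun p => ρ p.2 * q (p.1 - p.2)) a u)
      ((volume : Measure ℂ).prod volume)) :
    form (fun p => ρ p.2 * q (p.1 - p.2)) a u = ∫ w, ρ w * (a w * u w) *
      (starRingEnd ℂ) (∫ z, ker w z * ((starRingEnd ℂ) (q (z - w)) * u z)) := by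
  rw [form, integral_prod_symm _ h]
  simp only [formFun_inner]

lemma integrable_form_inner {ρ q : ℂ → ℂ} {a : ℂ →ᵇ ℂ} {u : L2E k}
    (h : Integrable (formFun (fun p => ρ p.2 * q (p.1 - p.2)) a u)
      ((volume : Measure ℂ).prod volume)) :
    Integrable fun w => ρ w * (a w * u w) *
      (starRingEnd ℂ) (∫ z, ker w z * ((starRingEnd ℂ) (q (z - w)) * u z)) := by
  have := h.integral_prod_right
  simpa only [formFun_inner] using this

/-! ### The weighted transfer and its bounds -/

/-- The density `|v|²`. -/
def dens (v : L2E k) : ℂ →ᵇ ℂ := star (toBCF k v) * toBCF k v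

lemma dens_apply (v : L2E k) (z : ℂ) : dens v z = ((‖v z‖ ^ 2 : ℝ) : ℂ) := by
  change (starRingEnd ℂ) (v z) * v z = _
  rw [mul_comm, Complex.mul_conj, Complex.normSq_eq_norm_sq]

lemma norm_dens_le (v : L2E k) : ‖dens v‖ ≤ supConst ^ 2 * l2norm v ^ 2 := by
  have h := v.norm_toBCF_le
  refine (norm_mul_le _ _).trans ?_
  rw [norm_star, ← sq, ← mul_pow]
  gcongr

lemma im_integral_dens_mul_eq_zero (ρ : ℂ → ℝ) (v u : L2E k) :
    (∫ w, (ρ w : ℂ) * (dens v w * u w) * (starRingEnd ℂ) (u w)).im = 0 := by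
  have : ∀ w, (ρ w : ℂ) * (dens v w * u w) * (starRingEnd ℂ) (u w) =
      ((ρ w * (‖v w‖ ^ 2 * ‖u w‖ ^ 2) : ℝ) : ℂ) := by
    intro w
    rw [dens_apply, mul_assoc, mul_assoc, Complex.mul_conj, Complex.normSq_eq_norm_sq]
    push_cast; ring
  simp only [this, integral_complex_ofReal, Complex.ofReal_im]

lemma integrable_formFun_left (k : ℕ) (a : ℂ →ᵇ ℂ) (u : L2E k) :
    Integrable (formFun (fun p => ((bracket p.1 ^ (2 * k) : ℝ) : ℂ)) a u)
      ((volume : Measure ℂ).prod volume) := by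
  obtain ⟨c, hc, h⟩ := exists_form_le k
  refine (h k k le_rfl le_rfl _ (by fun_prop) 1 zero_le_one (fun z w => ?_) a u).1
  rw [one_mul, Complex.norm_real, Real.norm_eq_abs, abs_of_pos (pow_pos (bracket_pos z) _), two_mul]
  have := bracket_pow_add_le k k w z
  rwa [norm_sub_rev, mul_comm (bracket w ^ k)] at this

lemma integrable_formFun_right (k : ℕ) (a : ℂ →ᵇ ℂ) (u : L2E k) :
    Integrable (formFun (fun p => ((bracket p.2 ^ (2 * k) : ℝ) : ℂ)) a u)
      ((volume : Measure ℂ).prod volume) := by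
  obtain ⟨c, hc, h⟩ := exists_form_le k
  refine (h k k le_rfl le_rfl _ (by fun_prop) 1 zero_le_one (fun z w => ?_) a u).1
  rw [one_mul, Complex.norm_real, Real.norm_eq_abs, abs_of_pos (pow_pos (bracket_pos w) _), two_mul]
  exact bracket_pow_add_le k k z w

/-- With the weight at `w`, the `z`-integral reproduces `conj (u w)`, and the integrand becomes
`⟨w⟩^{2k} |v|² |u|²`, which is real. -/
lemma form_right_im (v u : L2E k) :
    (form (fun p => ((bracket p.2 ^ (2 * k) : ℝ) : ℂ)) (dens v) u).im = 0 := by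
  have hi := integrable_formFun_right k (dens v) u
  have h := form_eq_integral (ρ := fun w => ((bracket w ^ (2 * k) : ℝ) : ℂ)) (q := fun _ => 1)
    (a := dens v) (u := u) (by simpa only [mul_one] using hi)
  simp only [map_one, one_mul, mul_one, ker_reproduces u.mem_fock] at h
  rw [h]
  exact im_integral_dens_mul_eq_zero _ v u

/-- The quantity `Im ⟨Π(|v|² u), u⟩` in `L^{2,k}_E`. -/
def transfer (v u : L2E k) : ℝ :=
  (inner ℂ (toL2ᵢ k u) (toL2ᵢ k (toeplitz k (dens v) u))).im

lemma transfer_eq (v u : L2E k) : transfer v u =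
    (form (fun p => ((bracket p.1 ^ (2 * k) : ℝ) : ℂ)) (dens v) u).im := by
  rw [transfer, form, integral_prod _ (integrable_formFun_left k (dens v) u), L2.inner_def]
  congr 1
  refine integral_congr_ae ?_
  filter_upwards [u.coeFn_toL2ᵢ, (toeplitz k (dens v) u).coeFn_toL2ᵢ] with z h1 h2
  rw [h1, h2, RCLike.inner_apply, weighted, weighted, toeplitz_apply, kerInt,
    ← integral_const_mul, ← integral_mul_const]
  refine integral_congr_ae (Filter.Eventually.of_forall fun w => ?_)
  simp only [formFun, map_mul, Complex.conj_ofReal]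
  push_cast; ring

/-- Subtracting a form with zero imaginary part makes the weight vanish on the diagonal, as in a
commutator estimate. -/
lemma transfer_eq_sub (v u : L2E k) : transfer v u =
    (form (fun p => ((bracket p.1 ^ (2 * k) : ℝ) : ℂ) - ((bracket p.2 ^ (2 * k) : ℝ) : ℂ))
      (dens v) u).im := by
  rw [form_sub (integrable_formFun_left k _ u) (integrable_formFun_right k _ u), Complex.sub_im,
    form_right_im, sub_zero, transfer_eq]

lemma transfer_eq_zero (v u : L2E 0) : transfer v u = 0 := by
  rw [transfer_eq_sub, form]
  simp [formFun]

/-- One of the two factors `u` carries only the weight `⟨z⟩^k`. This gain is what makes the growth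
polynomial rather than exponential. -/
lemma exists_abs_transfer_le (k : ℕ) : ∃ c : ℝ, 0 ≤ c ∧ ∀ v u : L2E (k + 1),
    |transfer v u| ≤ c * (l2norm v ^ 2 * (‖u‖ * l2norm (weighted k u))) := by
  obtain ⟨c, hc, h⟩ := exists_form_le (3 * k + 3)
  refine ⟨2 * (k + 1) * c * supConst ^ 2, by positivity, fun v u => ?_⟩
  rw [transfer_eq_sub]
  refine (Complex.abs_im_le_norm _).trans ((h (k + 1) k le_rfl (Nat.le_succ k) _ (by fun_prop)
    (2 * (k + 1)) (by positivity) (fun z w => ?_) (dens v) u).2.trans ?_)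
  · rw [← Complex.ofReal_sub, Complex.norm_real, Real.norm_eq_abs]
    exact abs_bracket_pow_sub_le k z w
  · rw [norm_eq u]
    have := v.norm_dens_le
    have := l2norm_nonneg (weighted (k + 1) u)
    have := l2norm_nonneg (weighted k u)
    calc _ ≤ 2 * (k + 1) * c * ((supConst ^ 2 * l2norm v ^ 2) *
        (l2norm (weighted (k + 1) u) * l2norm (weighted k u))) := by gcongr
      _ = _ := by ring

/-! ### Cancellation of the first-order terms -/

lemma integrable_formFun_lin₁ (n : ℕ) (a : ℂ →ᵇ ℂ) (u : L2E (n + 1)) :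
    Integrable (formFun (fun p => (bracket p.2 : ℂ) ^ (2 * n) * (starRingEnd ℂ) p.2 * (p.1 - p.2)) a u)
      ((volume : Measure ℂ).prod volume) := by
  obtain ⟨c, hc, h⟩ := exists_form_le (n + 1)
  refine (h n (n + 1) (Nat.le_succ n) le_rfl _ (by fun_prop) 1 zero_le_one (fun z w => ?_) a u).1
  simp only [norm_mul, norm_pow, Complex.norm_real, Real.norm_eq_abs, RCLike.norm_conj,
    abs_of_pos (bracket_pos w), one_mul]
  have h1 := bracket_pow_add_le n (n + 1) z w
  have h2 := norm_le_bracket w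
  have h3 := bracket_pos w
  calc bracket w ^ (2 * n) * ‖w‖ * ‖z - w‖ ≤ bracket w ^ (2 * n) * bracket w * (1 + ‖z - w‖) := by
        gcongr; linarith
    _ = bracket w ^ (n + (n + 1)) * (1 + ‖z - w‖) := by ring
    _ ≤ ((1 + ‖z - w‖) ^ n * (bracket z ^ n * bracket w ^ (n + 1))) * (1 + ‖z - w‖) := by gcongr
    _ = _ := by ring

lemma integrable_formFun_lin₂ (n : ℕ) (a : ℂ →ᵇ ℂ) (u : L2E (n + 1)) :
    Integrable (formFun (fun p => (bracket p.2 : ℂ) ^ (2 * n) * p.2 * (starRingEnd ℂ) (p.1 - p.2)) a u)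
      ((volume : Measure ℂ).prod volume) := by
  refine (integrable_formFun_lin₁ n a u).mono ?_ (Filter.Eventually.of_forall fun p => le_of_eq ?_)
  · have hu := u.continuous
    have ha := a.continuous
    have : Continuous (formFun (fun p => (bracket p.2 : ℂ) ^ (2 * n) * p.2 *
        (starRingEnd ℂ) (p.1 - p.2)) a u) := by
      unfold formFun
      have c1 := continuous_ker
      fun_prop
    exact this.aestronglyMeasurable
  · simp only [formFun, norm_mul, RCLike.norm_conj]

lemma integrable_formFun_lin (n : ℕ) (a : ℂ →ᵇ ℂ) (u : L2E (n + 1)) :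
    Integrable (formFun (fun p => ((bracket p.2 ^ (2 * n) * linPart p.1 p.2 : ℝ) : ℂ)) a u)
      ((volume : Measure ℂ).prod volume) := by
  refine ((integrable_formFun_lin₁ n a u).add (integrable_formFun_lin₂ n a u)).congr
    (Filter.Eventually.of_forall fun p => ?_)
  simp only [formFun, Pi.add_apply, Complex.ofReal_mul, linPart_eq]
  push_cast; ring

/-- Of the two halves of `linPart`, the one with `conj (z - w)` contributes nothing: under the
conjugate it becomes the integral of `ker w z * ((z - w) * u z)`, which is zero. -/
lemma form_lin (n : ℕ) (a : ℂ →ᵇ ℂ) (u : L2E (n + 1)) :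
    form (fun p => ((bracket p.2 ^ (2 * n) * linPart p.1 p.2 : ℝ) : ℂ)) a u =
      ∫ w, (bracket w : ℂ) ^ (2 * n) * (starRingEnd ℂ) w * (a w * u w) *
        (starRingEnd ℂ) (∫ z, ker w z * ((starRingEnd ℂ) (z - w) * u z)) := by
  obtain ⟨⟨f, hf, huf⟩, h2⟩ := u.mem_fock
  have e1 := form_eq_integral (ρ := fun w => (bracket w : ℂ) ^ (2 * n) * (starRingEnd ℂ) w)
    (q := fun x => x) (integrable_formFun_lin₁ n a u)
  have e2 := form_eq_integral (ρ := fun w => (bracket w : ℂ) ^ (2 * n) * w)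
    (q := fun x => (starRingEnd ℂ) x) (integrable_formFun_lin₂ n a u)
  simp only [Complex.conj_conj, integral_ker_mul_sub hf huf h2, map_zero, mul_zero,
    integral_zero] at e2
  have e3 := form_add (integrable_formFun_lin₁ n a u) (integrable_formFun_lin₂ n a u)
  rw [e2, add_zero] at e3
  rw [← e1, ← e3]
  congr 1
  funext p
  simp only [Complex.ofReal_mul, linPart_eq]
  push_cast; ring

/-- By the product rule, the two terms combine into the radial integral of `h conj(w h')` with `h =
f g`, up to a real integrand; its imaginary part is zero by rotation invariance. -/
lemma form_lin_im_add (n : ℕ) (v u : L2E (n + 1)) :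
    (form (fun p => ((bracket p.2 ^ (2 * n) * linPart p.1 p.2 : ℝ) : ℂ)) (dens v) u).im +
    (form (fun p => ((bracket p.2 ^ (2 * n) * linPart p.1 p.2 : ℝ) : ℂ)) (dens u) v).im = 0 := by
  obtain ⟨⟨f, hf, huf⟩, h2⟩ := u.mem_fock
  obtain ⟨⟨g, hg, hvg⟩, h3⟩ := v.mem_fock
  have i1 := integrable_form_inner (ρ := fun w => (bracket w : ℂ) ^ (2 * n) * (starRingEnd ℂ) w)
    (q := fun x => x) (integrable_formFun_lin₁ n (dens v) u)
  have i2 := integrable_form_inner (ρ := fun w => (bracket w : ℂ) ^ (2 * n) * (starRingEnd ℂ) w)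
    (q := fun x => x) (integrable_formFun_lin₁ n (dens u) v)
  rw [form_lin, form_lin, ← Complex.add_im, ← integral_add i1 i2]
  have i3 := integral_im (i1.add i2)
  simp only [RCLike.im_eq_complex_im, Pi.add_apply] at i3
  -- Four factors `exp (-|w|²/2)`: two from the density, one from the function and one from the
  -- inner integral.
  rw [← i3, ← integral_radial_im_eq_zero (hf.mul hg)
    (fun r => (1 + r ^ 2) ^ n * Real.exp (-(r ^ 2) / 2) ^ 4)]
  refine integral_congr_ae (Filter.Eventually.of_forall fun w => ?_)
  simp only
  rw [integral_ker_mul_conj_sub hf huf h2, integral_ker_mul_conj_sub hg hvg h3, dens_apply,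
    dens_apply, huf, hvg]
  have hb : (bracket w : ℂ) ^ (2 * n) = (((1 + ‖w‖ ^ 2) ^ n : ℝ) : ℂ) := by
    rw [pow_mul, ← bracket_sq]; push_cast; rfl
  rw [hb]
  generalize Real.exp (-(‖w‖ ^ 2) / 2) = e
  generalize (1 + ‖w‖ ^ 2) ^ n = b
  have hd : deriv (f * g) w = deriv f w * g w + f w * deriv g w := deriv_mul (hf w) (hg w)
  have n2 : ∀ y : ℂ, ((‖(e : ℂ) * y‖ ^ 2 : ℝ) : ℂ) = (e : ℂ) ^ 2 * (y * (starRingEnd ℂ) y) := by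
    intro y
    rw [Complex.mul_conj, Complex.normSq_eq_norm_sq, norm_mul, Complex.norm_real, mul_pow,
      Real.norm_eq_abs, sq_abs]
    push_cast; rfl
  rw [hd, n2, n2]
  -- The terms `-conj w * f w` and `-conj w * g w` of the inner integrals produce only the real
  -- correction on the last line.
  have key : (b : ℂ) * (starRingEnd ℂ) w * ((e : ℂ) ^ 2 * (g w * (starRingEnd ℂ) (g w)) * (e * f w)) *
      (starRingEnd ℂ) (e * (deriv f w - (starRingEnd ℂ) w * f w)) +
      b * (starRingEnd ℂ) w * ((e : ℂ) ^ 2 * (f w * (starRingEnd ℂ) (f w)) * (e * g w)) *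
      (starRingEnd ℂ) (e * (deriv g w - (starRingEnd ℂ) w * g w)) =
      ((b * e ^ 4 : ℝ) : ℂ) * ((f * g) w *
        (starRingEnd ℂ) (w * (deriv f w * g w + f w * deriv g w))) -
      ((2 * b * e ^ 4 * ‖w‖ ^ 2 * ‖f w‖ ^ 2 * ‖g w‖ ^ 2 : ℝ) : ℂ) := by
    have m2 : ∀ y : ℂ, (‖y‖ : ℂ) ^ 2 = y * (starRingEnd ℂ) y := fun y => by
      rw [Complex.mul_conj, Complex.normSq_eq_norm_sq]; push_cast; rfl
    simp only [Complex.ofReal_mul, Complex.ofReal_pow, m2, map_mul, map_sub, map_add,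
      Complex.conj_ofReal, Complex.conj_conj, Pi.mul_apply, Complex.ofReal_ofNat]
    ring
  rw [key, Complex.sub_im, Complex.ofReal_im, sub_zero, Complex.im_ofReal_mul]

/-- The kernel `ker w z * ‖z - w‖²` reproduces `u` as well, so the form is the integral of `|v|²
|u|²`. -/
lemma form_dist_im (v u : L2E 1) :
    (form (fun p => ((‖p.1 - p.2‖ ^ 2 : ℝ) : ℂ)) (dens v) u).im = 0 := by
  obtain ⟨⟨f, hf, huf⟩, h2⟩ := u.mem_fock
  obtain ⟨c, hc, h⟩ := exists_form_le 2
  have hi := (h 0 0 zero_le_one zero_le_one (fun p => ((‖p.1 - p.2‖ ^ 2 : ℝ) : ℂ)) (by fun_prop) 1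
    zero_le_one (fun z w => by
      rw [Complex.norm_real, Real.norm_eq_abs, abs_of_nonneg (by positivity), pow_zero, pow_zero,
        mul_one, mul_one, one_mul]
      gcongr; linarith) (dens v) u).1
  have e := form_eq_integral (ρ := fun _ => 1) (q := fun x => ((‖x‖ ^ 2 : ℝ) : ℂ)) (a := dens v)
    (u := u) (by simpa only [one_mul] using hi)
  simp only [one_mul, Complex.conj_ofReal, Complex.ofReal_pow, map_pow,
    integral_ker_mul_norm_sq_sub hf huf h2] at e
  simp only [Complex.ofReal_pow]
  rw [e]
  simpa using im_integral_dens_mul_eq_zero (fun _ => 1) v u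

/-- Here the expansion is exact: `⟨z⟩² - ⟨w⟩² = linPart z w + ‖z - w‖²`. The last term gives a real
form and the linear ones cancel. -/
lemma transfer_add_transfer_eq_zero (v u : L2E 1) : transfer v u + transfer u v = 0 := by
  have key : ∀ v u : L2E 1, transfer v u =
      (form (fun p => ((bracket p.2 ^ (2 * 0) * linPart p.1 p.2 : ℝ) : ℂ)) (dens v) u).im := by
    intro v u
    obtain ⟨c, hc, h⟩ := exists_form_le 2
    have hi := (h 0 0 zero_le_one zero_le_one (fun p => ((‖p.1 - p.2‖ ^ 2 : ℝ) : ℂ)) (by fun_prop) 1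
      zero_le_one (fun z w => by
        rw [Complex.norm_real, Real.norm_eq_abs, abs_of_nonneg (by positivity), pow_zero, pow_zero,
          mul_one, mul_one, one_mul]
        gcongr; linarith) (dens v) u).1
    rw [transfer_eq_sub, ← add_zero (Complex.im (form (fun p => ((bracket p.2 ^ (2 * 0) *
      linPart p.1 p.2 : ℝ) : ℂ)) (dens v) u)), ← form_dist_im v u, ← Complex.add_im,
      ← form_add (integrable_formFun_lin 0 _ u) hi]
    congr 2
    funext p
    rw [linPart]; push_cast; ring
  rw [key, key]
  exact form_lin_im_add 0 v u

/-- After the linear terms cancel, only the Taylor remainder `R` is left, with weight `n + 1` on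
each factor. -/
lemma exists_abs_transfer_add_transfer_le (n : ℕ) : ∃ c : ℝ, 0 ≤ c ∧ ∀ v u : L2E (n + 2),
    |transfer v u + transfer u v| ≤ c * (l2norm v ^ 2 * l2norm (weighted (n + 1) u) ^ 2 +
      l2norm u ^ 2 * l2norm (weighted (n + 1) v) ^ 2) := by
  obtain ⟨c, hc, h⟩ := exists_form_le (3 * n + 5)
  let Φ₁ : ℂ × ℂ → ℂ := fun p => ((bracket p.2 ^ (2 * (n + 1)) * linPart p.1 p.2 : ℝ) : ℂ)
  let R : ℂ × ℂ → ℂ := fun p => ((bracket p.1 ^ (2 * (n + 2)) - bracket p.2 ^ (2 * (n + 2)) -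
      (n + 2) * (bracket p.2 ^ (2 * (n + 1)) * linPart p.1 p.2) : ℝ) : ℂ)
  have hR : Continuous R := by simp only [R, linPart]; fun_prop
  have hRb := fun (v u : L2E (n + 2)) => h (n + 1) (n + 1) (Nat.le_succ _) (Nat.le_succ _) R hR
    (5 * (n + 2) ^ 2) (by positivity) (fun z w => by
      rw [Complex.norm_real, Real.norm_eq_abs]
      exact abs_bracket_pow_sub_linPart_le n z w) (dens v) u
  have key : ∀ v u : L2E (n + 2), transfer v u =
      (n + 2) * (form Φ₁ (dens v) u).im + (form R (dens v) u).im := by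
    intro v u
    have hΦ := integrable_formFun_lin (n + 1) (dens v) u
    have hΦ' : Integrable (formFun (fun p => ((n + 2 : ℝ) : ℂ) * Φ₁ p) (dens v) u)
        ((volume : Measure ℂ).prod volume) := by
      refine (hΦ.const_mul ((n + 2 : ℝ) : ℂ)).congr (Filter.Eventually.of_forall fun p => ?_)
      simp only [formFun, Φ₁]; ring
    rw [transfer_eq_sub, ← Complex.im_ofReal_mul, ← form_const_mul, ← Complex.add_im,
      ← form_add hΦ' (hRb v u).1]
    congr 2
    funext p
    simp only [Φ₁, R]; push_cast; ring
  refine ⟨5 * (n + 2) ^ 2 * c * supConst ^ 2, by positivity, fun v u => ?_⟩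
  have h0 : (form Φ₁ (dens v) u).im + (form Φ₁ (dens u) v).im = 0 := form_lin_im_add (n + 1) v u
  have e : transfer v u + transfer u v = (form R (dens v) u).im + (form R (dens u) v).im := by
    rw [key, key]; linear_combination (n + 2 : ℝ) * h0
  have hb : ∀ v u : L2E (n + 2), |(form R (dens v) u).im| ≤
      5 * (n + 2) ^ 2 * c * supConst ^ 2 * (l2norm v ^ 2 * l2norm (weighted (n + 1) u) ^ 2) := by
    intro v u
    refine (Complex.abs_im_le_norm _).trans ((hRb v u).2.trans ?_)
    have := v.norm_dens_le
    have := l2norm_nonneg (weighted (n + 1) u)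
    calc _ ≤ 5 * (n + 2) ^ 2 * c * ((supConst ^ 2 * l2norm v ^ 2) *
        (l2norm (weighted (n + 1) u) * l2norm (weighted (n + 1) u))) := by gcongr
      _ = _ := by ring
  rw [e]
  refine (abs_add_le _ _).trans ((add_le_add (hb v u) (hb u v)).trans (le_of_eq ?_))
  ring

end L2E

/-! ### Ordinary differential equations with a priori bounds -/

section Cutoff

variable {E : Type*} [NormedAddCommGroup E]

/-- A cutoff function of the norm, equal to `1` on the ball of radius `R`. -/
def cutoff (R : ℝ) (x : E) : ℝ := max 0 (min 1 (R + 1 - ‖x‖))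

lemma cutoff_nonneg (R : ℝ) (x : E) : 0 ≤ cutoff R x := le_max_left _ _

lemma cutoff_le_one (R : ℝ) (x : E) : cutoff R x ≤ 1 := max_le zero_le_one (min_le_left _ _)

lemma cutoff_of_le {R : ℝ} {x : E} (h : ‖x‖ ≤ R) : cutoff R x = 1 := by
  rw [cutoff, min_eq_left (by linarith), max_eq_right zero_le_one]

lemma cutoff_of_ge {R : ℝ} {x : E} (h : R + 1 ≤ ‖x‖) : cutoff R x = 0 :=
  max_eq_left ((min_le_right _ _).trans (by linarith))

lemma abs_cutoff_sub_le (R : ℝ) (x y : E) : |cutoff R x - cutoff R y| ≤ ‖x - y‖ := by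
  have h1 := abs_norm_sub_norm_le x y
  have h2 := abs_max_sub_max_le_abs (min 1 (R + 1 - ‖x‖)) (min 1 (R + 1 - ‖y‖)) 0
  have h3 := abs_min_sub_min_le_max 1 (R + 1 - ‖x‖) 1 (R + 1 - ‖y‖)
  rw [max_comm, max_comm (min 1 (R + 1 - ‖y‖))] at h2
  refine h2.trans (h3.trans (max_le (by simp) ?_))
  rw [show R + 1 - ‖x‖ - (R + 1 - ‖y‖) = -(‖x‖ - ‖y‖) by ring, abs_neg]
  exact h1

end Cutoff

section ODE

variable {E : Type*} [NormedAddCommGroup E] [NormedSpace ℝ E] {F : E → E}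

/-- The truncated field vanishes outside the ball of radius `R + 1`, so the bounds on that ball
become global ones. -/
lemma exists_bounds_cutoff_smul (hF : ∀ R : ℝ, ∃ K : NNReal, LipschitzOnWith K F (Metric.closedBall 0 R))
    {R : ℝ} (hR : 0 ≤ R) : ∃ K L : NNReal, LipschitzWith K (fun x => cutoff R x • F x) ∧
      ∀ x, ‖cutoff R x • F x‖ ≤ L := by
  obtain ⟨K, hK⟩ := hF (R + 1)
  let L : NNReal := ⟨‖F 0‖ + K * (R + 1), by positivity⟩
  have hL : ∀ x : E, ‖x‖ ≤ R + 1 → ‖F x‖ ≤ L := by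
    intro x hx
    have h1 := hK.norm_sub_le (mem_closedBall_zero_iff.2 hx)
      (Metric.mem_closedBall_self (by linarith : 0 ≤ R + 1))
    rw [sub_zero] at h1
    have h2 : ‖F x‖ ≤ ‖F 0‖ + ‖F x - F 0‖ := by simpa using norm_add_le (F 0) (F x - F 0)
    change ‖F x‖ ≤ ‖F 0‖ + K * (R + 1)
    have : (K : ℝ) * ‖x‖ ≤ K * (R + 1) := by gcongr
    linarith
  have hbd : ∀ x : E, ‖cutoff R x • F x‖ ≤ L := by
    intro x
    rw [norm_smul, Real.norm_eq_abs, abs_of_nonneg (cutoff_nonneg R x)]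
    rcases le_total ‖x‖ (R + 1) with h | h
    · exact (mul_le_of_le_one_left (norm_nonneg _) (cutoff_le_one R x)).trans (hL x h)
    · rw [cutoff_of_ge h, zero_mul]; exact L.2
  -- If the cutoff vanishes at `y`, its value at `x` is at most `‖x - y‖`.
  have one_out : ∀ x y : E, R + 1 ≤ ‖y‖ →
      ‖cutoff R x • F x - cutoff R y • F y‖ ≤ (K + L : NNReal) * ‖x - y‖ := by
    intro x y hy
    have hc := abs_cutoff_sub_le R x y
    rw [cutoff_of_ge hy, zero_smul, sub_zero, norm_smul]
    rw [cutoff_of_ge hy, sub_zero] at hc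
    push_cast
    rcases le_total ‖x‖ (R + 1) with h | h
    · calc ‖cutoff R x‖ * ‖F x‖ ≤ ‖x - y‖ * L := by
            gcongr
            · exact hc
            · exact hL x h
        _ ≤ (K + L) * ‖x - y‖ := by nlinarith [K.2, norm_nonneg (x - y), mul_nonneg K.2 (norm_nonneg (x - y))]
    · rw [cutoff_of_ge h, norm_zero, zero_mul]; positivity
  refine ⟨K + L, L, LipschitzWith.of_dist_le_mul fun x y => ?_, hbd⟩
  rw [dist_eq_norm, dist_eq_norm]
  rcases le_total (R + 1) ‖y‖ with hy | hy
  · exact one_out x y hy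
  rcases le_total (R + 1) ‖x‖ with hx | hx
  · rw [norm_sub_rev, norm_sub_rev x]; exact one_out y x hx
  · have h1 := hK.norm_sub_le (mem_closedBall_zero_iff.2 hx) (mem_closedBall_zero_iff.2 hy)
    have e : cutoff R x • F x - cutoff R y • F y =
        cutoff R x • (F x - F y) + (cutoff R x - cutoff R y) • F y := by
      rw [smul_sub, sub_smul]; abel
    rw [e]
    refine (norm_add_le _ _).trans ?_
    rw [norm_smul, norm_smul, Real.norm_eq_abs, abs_of_nonneg (cutoff_nonneg R x), Real.norm_eq_abs]
    push_cast
    calc cutoff R x * ‖F x - F y‖ + |cutoff R x - cutoff R y| * ‖F y‖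
        ≤ 1 * (K * ‖x - y‖) + ‖x - y‖ * L := by
          gcongr
          · exact cutoff_le_one R x
          · exact abs_cutoff_sub_le R x y
          · exact hL y hy
      _ = _ := by ring

/-- Existence on a given interval, from a bound that is stable under slowing down the flow. -/
lemma exists_solution_Icc [CompleteSpace E]
    (hF : ∀ R : ℝ, ∃ K : NNReal, LipschitzOnWith K F (Metric.closedBall 0 R)) {x₀ : E} {T R : ℝ}
    (hT : 0 < T)
    (hap : ∀ (α : ℝ → E) (c : ℝ → ℝ), α 0 = x₀ → (∀ t, |c t| ≤ 1) →
      (∀ t ∈ Set.Icc (-T) T, HasDerivWithinAt α (c t • F (α t)) (Set.Icc (-T) T) t) →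
      ∀ t ∈ Set.Icc (-T) T, ‖α t‖ ≤ R) :
    ∃ α : ℝ → E, α 0 = x₀ ∧
      ∀ t ∈ Set.Icc (-T) T, HasDerivWithinAt α (F (α t)) (Set.Icc (-T) T) t := by
  obtain ⟨K, L, hK, hL⟩ := exists_bounds_cutoff_smul hF (le_max_right R 0)
  -- The truncated field is bounded by `L` everywhere, so the ball of radius `L * T` confines the
  -- solution up to time `T`.
  have hPL : IsPicardLindelof (fun _ x => cutoff (max R 0) x • F x)
      (tmin := -T) (tmax := T) ⟨0, by constructor <;> linarith⟩ x₀ (L * ⟨T, hT.le⟩) 0 L K :=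
    { lipschitzOnWith := fun t _ => hK.lipschitzOnWith
      continuousOn := fun x _ => continuousOn_const
      norm_le := fun t _ x _ => hL x
      mul_max_le := by
        simp only [sub_zero, zero_sub, neg_neg, max_self, NNReal.coe_zero]
        exact (NNReal.coe_mul L ⟨T, hT.le⟩).ge }
  obtain ⟨α, h0, hα⟩ := hPL.exists_eq_forall_mem_Icc_hasDerivWithinAt₀
  -- The truncated solution is the original flow slowed down by the cutoff. The a priori bound keeps
  -- it where the cutoff equals `1`, so it solves the original equation.
  have hb := hap α (fun t => cutoff (max R 0) (α t)) h0 (fun t => by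
    rw [abs_of_nonneg (cutoff_nonneg _ _)]; exact cutoff_le_one _ _) hα
  refine ⟨α, h0, fun t ht => ?_⟩
  have := hα t ht
  rwa [cutoff_of_le ((hb t ht).trans (le_max_left R 0)), one_smul] at this

lemma eqOn_of_hasDerivAt
    (hF : ∀ R : ℝ, ∃ K : NNReal, LipschitzOnWith K F (Metric.closedBall 0 R)) {α β : ℝ → E} {T : ℝ}
    (hα : ∀ t ∈ Set.Ioo (-T) T, HasDerivAt α (F (α t)) t)
    (hβ : ∀ t ∈ Set.Ioo (-T) T, HasDerivAt β (F (β t)) t) (h0 : α 0 = β 0) :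
    Set.EqOn α β (Set.Ioo (-T) T) := by
  intro t ht
  have hT : |t| < T := abs_lt.2 ht
  -- On the compact interval `[-S, S]` both curves are bounded, so one Lipschitz constant serves
  -- both.
  obtain ⟨S, hS1, hS2⟩ := exists_between hT
  have hsub : Set.Icc (-S) S ⊆ Set.Ioo (-T) T := fun s hs =>
    ⟨by linarith [hs.1], by linarith [hs.2]⟩
  have hsub' : Set.Ioo (-S) S ⊆ Set.Icc (-S) S := Set.Ioo_subset_Icc_self
  have cα : ContinuousOn α (Set.Icc (-S) S) := fun s hs => (hα s (hsub hs)).continuousAt.continuousWithinAt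
  have cβ : ContinuousOn β (Set.Icc (-S) S) := fun s hs => (hβ s (hsub hs)).continuousAt.continuousWithinAt
  obtain ⟨A, hA⟩ := isCompact_Icc.exists_bound_of_continuousOn cα
  obtain ⟨B, hB⟩ := isCompact_Icc.exists_bound_of_continuousOn cβ
  obtain ⟨K, hK⟩ := hF (max A B)
  exact ODE_solution_unique_of_mem_Icc (v := fun _ => F) (s := fun _ => Metric.closedBall 0 (max A B))
    (t₀ := 0) (fun _ _ => hK)
    ⟨by linarith [abs_nonneg t], by linarith [abs_nonneg t]⟩ cα
    (fun s hs => hα s (hsub (hsub' hs)))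
    (fun s hs => mem_closedBall_zero_iff.2 ((hA s (hsub' hs)).trans (le_max_left _ _))) cβ
    (fun s hs => hβ s (hsub (hsub' hs)))
    (fun s hs => mem_closedBall_zero_iff.2 ((hB s (hsub' hs)).trans (le_max_right _ _)))
    h0 (abs_le.1 hS1.le)

lemma exists_global_solution
    (hF : ∀ R : ℝ, ∃ K : NNReal, LipschitzOnWith K F (Metric.closedBall 0 R)) {x₀ : E}
    (hex : ∀ T : ℝ, 0 < T → ∃ α : ℝ → E, α 0 = x₀ ∧
      ∀ t ∈ Set.Icc (-T) T, HasDerivWithinAt α (F (α t)) (Set.Icc (-T) T) t) :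
    ∃ α : ℝ → E, α 0 = x₀ ∧ ∀ t, HasDerivAt α (F (α t)) t := by
  -- With `n + 1`, the interval has positive length and, for `n = ⌈|t|⌉₊`, contains `t` in its
  -- interior.
  choose A hA0 hA using fun n : ℕ => hex (n + 1) (by positivity)
  have hd : ∀ n : ℕ, ∀ t ∈ Set.Ioo (-(n + 1 : ℝ)) (n + 1), HasDerivAt (A n) (F (A n t)) t :=
    fun n t ht => (hA n t (Set.Ioo_subset_Icc_self ht)).hasDerivAt (Icc_mem_nhds ht.1 ht.2)
  have mono : ∀ n m : ℕ, n ≤ m → Set.EqOn (A n) (A m) (Set.Ioo (-(n + 1 : ℝ)) (n + 1)) := by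
    intro n m hnm
    have hc : (n : ℝ) ≤ m := by exact_mod_cast hnm
    exact eqOn_of_hasDerivAt hF (hd n)
      (fun t ht => hd m t ⟨by linarith [ht.1], by linarith [ht.2]⟩) ((hA0 n).trans (hA0 m).symm)
  have heq : ∀ n : ℕ, ∀ t ∈ Set.Ioo (-(n + 1 : ℝ)) (n + 1), A ⌈|t|⌉₊ t = A n t := by
    intro n t ht
    have h1 : t ∈ Set.Ioo (-((⌈|t|⌉₊ : ℝ) + 1)) (⌈|t|⌉₊ + 1) :=
      abs_lt.1 (lt_of_le_of_lt (Nat.le_ceil |t|) (by linarith))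
    rcases le_total ⌈|t|⌉₊ n with h | h
    · exact mono _ _ h h1
    · exact (mono _ _ h ht).symm
  refine ⟨fun t => A ⌈|t|⌉₊ t, hA0 _, fun t => ?_⟩
  have h1 : t ∈ Set.Ioo (-((⌈|t|⌉₊ : ℝ) + 1)) (⌈|t|⌉₊ + 1) :=
    abs_lt.1 (lt_of_le_of_lt (Nat.le_ceil |t|) (by linarith))
  refine (hd _ t h1).congr_of_eventuallyEq ?_
  filter_upwards [isOpen_Ioo.mem_nhds h1] with s hs
  exact heq _ s hs

lemma contDiff_of_hasDerivAt (hF : ContDiff ℝ ∞ F) {α : ℝ → E} (h : ∀ t, HasDerivAt α (F (α t)) t) :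
    ContDiff ℝ ∞ α := by
  rw [contDiff_infty]
  intro n
  induction n with
  | zero => exact contDiff_zero.2 (continuous_iff_continuousAt.2 fun t => (h t).continuousAt)
  | succ n ih =>
    have hd : deriv α = fun t => F (α t) := funext fun t => (h t).deriv
    push_cast
    rw [contDiff_succ_iff_deriv]
    refine ⟨fun t => (h t).differentiableAt, by simp, ?_⟩
    rw [hd]
    exact (contDiff_infty.1 hF n).comp ih

end ODE

/-! ### The vector field of the system -/

namespace L2E

variable {k : ℕ}

/-- The vector field `(u, v) ↦ (-i Π(|v|² u), i Π(|u|² v))`. -/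
def field (k : ℕ) (U : L2E k × L2E k) : L2E k × L2E k :=
  (-Complex.I • toeplitz k (dens U.2) U.1, Complex.I • toeplitz k (dens U.1) U.2)

/-- Exchanging the two unknowns reverses time, so estimates for the first component carry over to
the second. -/
lemma field_swap (U : L2E k × L2E k) : field k U.swap = -(field k U).swap := by
  simp [field]

lemma contDiff_dens : ContDiff ℝ ∞ (dens : L2E k → ℂ →ᵇ ℂ) := by
  have h1 : ContDiff ℝ ∞ (toBCF k) := ((toBCF k).restrictScalars ℝ).contDiff
  have h2 : ContDiff ℝ ∞ (star : (ℂ →ᵇ ℂ) → (ℂ →ᵇ ℂ)) :=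
    (starL' ℝ : (ℂ →ᵇ ℂ) ≃L[ℝ] (ℂ →ᵇ ℂ)).contDiff
  have h3 : ContDiff ℝ ∞ fun p : (ℂ →ᵇ ℂ) × (ℂ →ᵇ ℂ) => p.1 * p.2 := contDiff_mul
  have h4 : ContDiff ℝ ∞ fun u : L2E k => star (toBCF k u) := h2.comp h1
  exact h3.comp (h4.prodMk h1)

lemma contDiff_field : ContDiff ℝ ∞ (field k) := by
  have hB : ContDiff ℝ ∞ fun p : (ℂ →ᵇ ℂ) × L2E k => toeplitz k p.1 p.2 :=
    ((toeplitz k).isBoundedBilinearMap.contDiff (n := ∞)).restrict_scalars ℝ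
  have h1 : ContDiff ℝ ∞ ((fun p : (ℂ →ᵇ ℂ) × L2E k => toeplitz k p.1 p.2) ∘
      fun U : L2E k × L2E k => (dens U.2, U.1)) := by
    apply ContDiff.comp
    · exact hB
    · exact (contDiff_dens.comp contDiff_snd).prodMk contDiff_fst
  have h2 : ContDiff ℝ ∞ ((fun p : (ℂ →ᵇ ℂ) × L2E k => toeplitz k p.1 p.2) ∘
      fun U : L2E k × L2E k => (dens U.1, U.2)) := by
    apply ContDiff.comp
    · exact hB
    · exact (contDiff_dens.comp contDiff_fst).prodMk contDiff_snd
  exact (h1.const_smul _).prodMk (h2.const_smul _)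

lemma norm_dens_sub_le {R : ℝ} {v v' : L2E k} (hv : ‖v‖ ≤ R) (hv' : ‖v'‖ ≤ R) :
    ‖dens v - dens v'‖ ≤ 2 * R * ‖toBCF k‖ ^ 2 * ‖v - v'‖ := by
  have e : dens v - dens v' = star (toBCF k (v - v')) * toBCF k v +
      star (toBCF k v') * toBCF k (v - v') := by
    simp only [dens, map_sub, star_sub]; ring
  have h := fun w : L2E k => (toBCF k).le_opNorm w
  rw [e]
  refine (norm_add_le _ _).trans ((add_le_add (norm_mul_le _ _) (norm_mul_le _ _)).trans ?_)
  rw [norm_star, norm_star]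
  calc _ ≤ (‖toBCF k‖ * ‖v - v'‖) * (‖toBCF k‖ * R) + (‖toBCF k‖ * R) * (‖toBCF k‖ * ‖v - v'‖) := by
        have hR : 0 ≤ R := (norm_nonneg v).trans hv
        gcongr
        · exact h _
        · exact (h v).trans (by gcongr)
        · exact (h v').trans (by gcongr)
        · exact h _
    _ = _ := by ring

lemma norm_toeplitz_dens_sub_le {R : ℝ} {u u' v v' : L2E k} (hu : ‖u‖ ≤ R)
    (hv : ‖v‖ ≤ R) (hv' : ‖v'‖ ≤ R) :
    ‖toeplitz k (dens v) u - toeplitz k (dens v') u'‖ ≤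
      ‖toeplitz k‖ * ‖toBCF k‖ ^ 2 * R ^ 2 * (2 * ‖v - v'‖ + ‖u - u'‖) := by
  have hR : 0 ≤ R := (norm_nonneg u).trans hu
  have e : toeplitz k (dens v) u - toeplitz k (dens v') u' =
      toeplitz k (dens v - dens v') u + toeplitz k (dens v') (u - u') := by
    simp only [map_sub, sub_apply]; abel
  have h0 : ‖dens v'‖ ≤ ‖toBCF k‖ ^ 2 * R ^ 2 := by
    refine (norm_mul_le _ _).trans ?_
    rw [norm_star, ← sq, ← mul_pow]
    gcongr
    exact ((toBCF k).le_opNorm v').trans (by gcongr)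
  rw [e]
  refine (norm_add_le _ _).trans
    ((add_le_add ((toeplitz k).le_opNorm₂ _ _) ((toeplitz k).le_opNorm₂ _ _)).trans ?_)
  calc _ ≤ ‖toeplitz k‖ * (2 * R * ‖toBCF k‖ ^ 2 * ‖v - v'‖) * R +
        ‖toeplitz k‖ * (‖toBCF k‖ ^ 2 * R ^ 2) * ‖u - u'‖ := by
        gcongr
        exact norm_dens_sub_le hv hv'
    _ = _ := by ring

lemma lipschitzOnWith_field (R : ℝ) :
    ∃ K : NNReal, LipschitzOnWith K (field k) (Metric.closedBall 0 R) := by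
  -- The factor `3` is `2` for the quadratic density plus `1` for the linear argument.
  refine ⟨⟨‖toeplitz k‖ * ‖toBCF k‖ ^ 2 * R ^ 2 * 3, by positivity⟩,
    LipschitzOnWith.of_dist_le_mul fun U hU V hV => ?_⟩
  rw [mem_closedBall_zero_iff] at hU hV
  have hU1 := (norm_fst_le U).trans hU
  have hU2 := (norm_snd_le U).trans hU
  have hV1 := (norm_fst_le V).trans hV
  have hV2 := (norm_snd_le V).trans hV
  have d1 := norm_fst_le (U - V)
  have d2 := norm_snd_le (U - V)
  have hI : ‖-Complex.I‖ = 1 := by simp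
  rw [dist_eq_norm, dist_eq_norm]
  change ‖field k U - field k V‖ ≤ ‖toeplitz k‖ * ‖toBCF k‖ ^ 2 * R ^ 2 * 3 * ‖U - V‖
  rw [mul_assoc]
  refine norm_prod_le_iff.2 ⟨?_, ?_⟩
  · simp only [field, Prod.fst_sub, ← smul_sub, norm_smul, hI, one_mul]
    refine (norm_toeplitz_dens_sub_le hU1 hU2 hV2).trans ?_
    rw [Prod.fst_sub] at d1
    rw [Prod.snd_sub] at d2
    gcongr
    linarith
  · simp only [field, Prod.snd_sub, ← smul_sub, norm_smul, Complex.norm_I, one_mul]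
    refine (norm_toeplitz_dens_sub_le hU2 hU1 hV1).trans ?_
    rw [Prod.fst_sub] at d1
    rw [Prod.snd_sub] at d2
    gcongr
    linarith

/-! ### Energy identities -/

lemma inner_real_eq (f g : Lp ℂ 2 (volume : Measure ℂ)) : inner ℝ f g = (inner ℂ f g).re := by
  rw [L2.inner_def, L2.inner_def]
  have := integral_re (L2.integrable_inner (𝕜 := ℂ) f g)
  simp only [RCLike.re_eq_complex_re] at this
  rw [← this]
  rfl

lemma hasDerivWithinAt_norm_sq {u : ℝ → L2E k} {u' : L2E k} {s : Set ℝ} {t : ℝ}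
    (h : HasDerivWithinAt u u' s t) : HasDerivWithinAt (fun t => ‖u t‖ ^ 2)
      (2 * (inner ℂ (toL2ᵢ k (u t)) (toL2ᵢ k u')).re) s t := by
  have h1 : HasDerivWithinAt (fun t => toL2ᵢ k (u t)) (toL2ᵢ k u') s t :=
    ((toL2ᵢ k).toContinuousLinearMap.restrictScalars ℝ).hasFDerivAt.comp_hasDerivWithinAt t h
  have h2 := h1.norm_sq
  rw [inner_real_eq] at h2
  simpa only [LinearIsometry.norm_map] using h2

/-- `U` follows, at speed `c`, the flow of the system on the time set `s`. -/
def IsFlow (s : Set ℝ) (c : ℝ → ℝ) (U : ℝ → L2E k × L2E k) : Prop :=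
  ∀ t ∈ s, HasDerivWithinAt U (c t • field k (U t)) s t

section Flow

variable {s : Set ℝ} {c : ℝ → ℝ} {U : ℝ → L2E k × L2E k}

lemma IsFlow.swap (h : IsFlow s c U) : IsFlow s (-c) fun t => (U t).swap := by
  intro t ht
  have h1 : HasDerivWithinAt (fun t => (U t).1) (c t • field k (U t)).1 s t := (h t ht).fst
  have h2 : HasDerivWithinAt (fun t => (U t).2) (c t • field k (U t)).2 s t := (h t ht).snd
  refine (h2.prodMk h1).congr_deriv ?_
  rw [field_swap]
  simp [Prod.swap]

lemma real_smul_eq (r : ℝ) (u : L2E k) : r • u = (r : ℂ) • u := rfl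

lemma IsFlow.hasDerivWithinAt_norm_sq_fst (h : IsFlow s c U) {t : ℝ} (ht : t ∈ s) :
    HasDerivWithinAt (fun t => ‖(U t).1‖ ^ 2) (2 * c t * transfer (U t).2 (U t).1) s t := by
  refine (hasDerivWithinAt_norm_sq (h t ht).fst).congr_deriv ?_
  simp only [Prod.smul_fst, field, real_smul_eq, map_smul, inner_smul_right, transfer]
  simp [Complex.mul_re, Complex.mul_im]
  ring

lemma IsFlow.hasDerivWithinAt_norm_sq_snd (h : IsFlow s c U) {t : ℝ} (ht : t ∈ s) :
    HasDerivWithinAt (fun t => ‖(U t).2‖ ^ 2) (-(2 * c t * transfer (U t).1 (U t).2)) s t := by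
  refine (h.swap.hasDerivWithinAt_norm_sq_fst ht).congr_deriv ?_
  simp only [Pi.neg_apply, Prod.fst_swap, Prod.snd_swap]
  ring

end Flow

/-- The inclusion of `L^{2,k}_E` in `L^{2,j}_E` for `j ≤ k`. -/
def incl {j k : ℕ} (h : j ≤ k) : L2E k →L[ℂ] L2E j :=
  LinearMap.mkContinuous
    { toFun := fun u => ⟨u, u.mem_fock, u.memLp_weighted h⟩
      map_add' := fun _ _ => rfl
      map_smul' := fun _ _ => rfl } 1
    fun u => by
      rw [one_mul, norm_eq]
      exact u.l2norm_weighted_le_norm h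

lemma incl_apply {j k : ℕ} (h : j ≤ k) (u : L2E k) (z : ℂ) : incl h u z = u z := rfl

lemma coe_incl {j k : ℕ} (h : j ≤ k) (u : L2E k) : (incl h u : ℂ → ℂ) = u := rfl

lemma norm_incl {j k : ℕ} (h : j ≤ k) (u : L2E k) : ‖incl h u‖ = l2norm (weighted j u) := by
  rw [norm_eq, coe_incl]

lemma norm_incl_zero (u : L2E k) : ‖incl (Nat.zero_le k) u‖ = l2norm u := by
  rw [norm_incl, weighted_zero]

/-- The integral operator does not depend on `k`, so a flow in `L^{2,k}_E` is also one for every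
smaller weight. Level `0` gives the conservation of mass. -/
lemma incl_toeplitz {j k : ℕ} (h : j ≤ k) (v u : L2E k) :
    incl h (toeplitz k (dens v) u) = toeplitz j (dens (incl h v)) (incl h u) := by
  refine ext fun z => ?_
  rw [incl_apply, toeplitz_apply, toeplitz_apply]
  simp only [dens_apply, incl_apply]

lemma IsFlow.incl {j k : ℕ} (h : j ≤ k) {s : Set ℝ} {c : ℝ → ℝ} {U : ℝ → L2E k × L2E k}
    (hU : IsFlow s c U) : IsFlow s c fun t => (L2E.incl h (U t).1, L2E.incl h (U t).2) := by
  intro t ht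
  have h1 := ((L2E.incl h).restrictScalars ℝ).hasFDerivAt.comp_hasDerivWithinAt t (hU t ht).fst
  have h2 := ((L2E.incl h).restrictScalars ℝ).hasFDerivAt.comp_hasDerivWithinAt t (hU t ht).snd
  refine (h1.prodMk h2).congr_deriv ?_
  simp only [field, ← incl_toeplitz, map_smul, ContinuousLinearMap.coe_restrictScalars',
    Prod.smul_mk]

/-- Conservation of mass. -/
lemma IsFlow.l2norm_fst {s : Set ℝ} {c : ℝ → ℝ} {U : ℝ → L2E k × L2E k} (hU : IsFlow s c U)
    (hs : Convex ℝ s) (h0 : (0 : ℝ) ∈ s) {t : ℝ} (ht : t ∈ s) :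
    l2norm (U t).1 = l2norm (U 0).1 := by
  have h1 := hU.incl (Nat.zero_le k)
  have h2 := hs.norm_image_sub_le_of_norm_hasDerivWithin_le (C := 0)
    (fun x hx => h1.hasDerivWithinAt_norm_sq_fst hx)
    (fun x hx => by rw [transfer_eq_zero, mul_zero, norm_zero]) h0 ht
  rw [zero_mul, norm_le_zero_iff, sub_eq_zero] at h2
  simp only [norm_incl_zero] at h2
  exact (pow_left_inj₀ (l2norm_nonneg _) (l2norm_nonneg _) two_ne_zero).1 h2

lemma IsFlow.l2norm_snd {s : Set ℝ} {c : ℝ → ℝ} {U : ℝ → L2E k × L2E k} (hU : IsFlow s c U)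
    (hs : Convex ℝ s) (h0 : (0 : ℝ) ∈ s) {t : ℝ} (ht : t ∈ s) :
    l2norm (U t).2 = l2norm (U 0).2 :=
  hU.swap.l2norm_fst hs h0 ht

/-! ### Growth of the weighted norms -/

/-- Hölder's inequality: pointwise, the left density is a geometric mean of the densities with
weights `k + 1` and `0`. -/
lemma l2norm_weighted_interp (u : L2E (k + 1)) : l2norm (weighted k u) ≤
    ‖u‖ ^ ((k : ℝ) / (k + 1)) * l2norm u ^ (1 / ((k : ℝ) + 1)) := by
  have hk : (0 : ℝ) < k + 1 := by positivity
  have hp : 0 ≤ (k : ℝ) / (k + 1) := by positivity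
  have hq : 0 ≤ 1 / ((k : ℝ) + 1) := by positivity
  have hpq : (k : ℝ) / (k + 1) + 1 / ((k : ℝ) + 1) = 1 := by field_simp
  have hu := u.continuous.measurable
  have hw := (continuous_weighted (k := k + 1) u.continuous).measurable
  have pt : ∀ z, ‖weighted k u z‖ₑ ^ (2 : ℝ) = (‖weighted (k + 1) u z‖ₑ ^ (2 : ℝ)) ^ ((k : ℝ) / (k + 1)) *
      (‖u z‖ₑ ^ (2 : ℝ)) ^ (1 / ((k : ℝ) + 1)) := by
    intro z
    have hb : ∀ n : ℕ, ‖weighted n u z‖ₑ = ENNReal.ofReal (bracket z) ^ (n : ℝ) * ‖u z‖ₑ := by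
      intro n
      rw [ENNReal.rpow_natCast, ← ENNReal.ofReal_pow (bracket_pos z).le, ← ofReal_norm,
        ← ofReal_norm, ← ENNReal.ofReal_mul (pow_nonneg (bracket_pos z).le n), norm_weighted]
    have h2 : (0 : ℝ) ≤ 2 := by norm_num
    rw [hb, hb, ENNReal.mul_rpow_of_nonneg _ _ h2, ENNReal.mul_rpow_of_nonneg _ _ h2,
      ENNReal.mul_rpow_of_nonneg _ _ hp, mul_assoc, ← ENNReal.rpow_mul, ← ENNReal.rpow_mul,
      ← ENNReal.rpow_mul, ← ENNReal.rpow_mul, ← ENNReal.rpow_mul,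
      ← ENNReal.rpow_add_of_nonneg _ _ (mul_nonneg h2 hp) (mul_nonneg h2 hq), ← mul_add, hpq,
      mul_one]
    congr 2
    push_cast; field_simp
  have h1 := ENNReal.lintegral_mul_norm_pow_le (μ := (volume : Measure ℂ))
    (f := fun z => ‖weighted (k + 1) u z‖ₑ ^ (2 : ℝ)) (g := fun z => ‖u z‖ₑ ^ (2 : ℝ))
    (hw.enorm.pow_const _).aemeasurable (hu.enorm.pow_const _).aemeasurable hp hq hpq
  simp only [← pt] at h1
  have h2 := ENNReal.rpow_le_rpow h1 (by norm_num : (0 : ℝ) ≤ 1 / 2)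
  have comm : ∀ (a : ENNReal) (x : ℝ), (a ^ x) ^ (1 / 2 : ℝ) = (a ^ (1 / 2 : ℝ)) ^ x := by
    intro a x; rw [← ENNReal.rpow_mul, ← ENNReal.rpow_mul, mul_comm]
  rw [ENNReal.mul_rpow_of_nonneg _ _ (by norm_num), comm _ ((k : ℝ) / (k + 1)),
    comm _ (1 / ((k : ℝ) + 1)), ← eLpNorm_two_eq, ← eLpNorm_two_eq, ← eLpNorm_two_eq] at h2
  have f1 := u.memLp.eLpNorm_ne_top
  have f2 := u.mem_fock.2.eLpNorm_ne_top
  have h3 := ENNReal.toReal_mono (ENNReal.mul_ne_top (ENNReal.rpow_ne_top_of_nonneg hp f1)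
    (ENNReal.rpow_ne_top_of_nonneg hq f2)) h2
  rw [ENNReal.toReal_mul, ← ENNReal.toReal_rpow, ← ENNReal.toReal_rpow] at h3
  rw [norm_eq]
  exact h3

lemma norm_eq_zero_of_l2norm {u : L2E k} (h : l2norm u = 0) : ‖u‖ = 0 := by
  have hz : u = 0 := ext fun z => by
    have := u.norm_apply_le_l2norm z
    rw [h, mul_zero] at this
    exact norm_le_zero_iff.1 this
  rw [hz, norm_zero]

/-- At level `k + 1`, with `a` the weighted norm, `m` the mass norm and `e = 1/(k+1)`, the transfer
is at most `C M a^(2 - e) m^e`, where `M` is the squared mass norm of the second component. So `a^e`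
grows at rate at most `C M m^e`, and `m ≤ a 0`. Allowing any speed `|c t| ≤ 1` covers both the
truncated and the time-reversed flows. -/
lemma exists_growth (k : ℕ) : ∃ C : ℝ, 0 < C ∧ ∀ (s : Set ℝ) (c : ℝ → ℝ) (U : ℝ → L2E k × L2E k),
    Convex ℝ s → (0 : ℝ) ∈ s → (∀ t, |c t| ≤ 1) → IsFlow s c U → ∀ t ∈ s,
      ‖(U t).1‖ ≤ ‖(U 0).1‖ * (1 + C * l2norm (U 0).2 ^ 2 * |t|) ^ k := by
  rcases k with _ | k
  · refine ⟨1, one_pos, fun s c U hs h0 hc hU t ht => ?_⟩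
    have := hU.l2norm_fst hs h0 ht
    rw [norm_eq, norm_eq, weighted_zero, weighted_zero, this, pow_zero, mul_one]
  obtain ⟨C, hC, hCb⟩ := exists_abs_transfer_le k
  refine ⟨C + 1, by linarith, fun s c U hs h0 hc hU t ht => ?_⟩
  set M := l2norm (U 0).2 ^ 2 with hM
  set m := l2norm (U 0).1 with hm
  have hm0 : 0 ≤ m := l2norm_nonneg _
  have hM0 : 0 ≤ M := sq_nonneg _
  have hmass : ∀ x ∈ s, l2norm (U x).1 = m := fun x hx => hU.l2norm_fst hs h0 hx
  rcases hm0.eq_or_lt with hz | hpos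
  -- Zero mass is treated apart, since differentiating the power `e` requires a nonzero norm.
  · have : l2norm (U t).1 = 0 := (hmass t ht).trans hz.symm
    rw [norm_eq_zero_of_l2norm this]
    positivity
  have hge : ∀ x ∈ s, m ≤ ‖(U x).1‖ := fun x hx => by
    rw [← hmass x hx]; exact l2norm_le_norm _
  set e : ℝ := 1 / (k + 1) with he
  have hk : (0 : ℝ) < k + 1 := by positivity
  have he0 : 0 < e := by positivity
  have he1 : e ≤ 1 := by rw [he, div_le_one hk]; linarith [(Nat.cast_nonneg k : (0 : ℝ) ≤ k)]
  have hder : ∀ x ∈ s, HasDerivWithinAt (fun x => (‖(U x).1‖ ^ 2) ^ (e / 2))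
      ((2 * c x * transfer (U x).2 (U x).1) * (e / 2) * (‖(U x).1‖ ^ 2) ^ (e / 2 - 1)) s x := by
    intro x hx
    refine (hU.hasDerivWithinAt_norm_sq_fst hx).rpow_const (Or.inl ?_)
    exact (pow_pos (hpos.trans_le (hge x hx)) 2).ne'
  have hbound : ∀ x ∈ s, ‖(2 * c x * transfer (U x).2 (U x).1) * (e / 2) *
      (‖(U x).1‖ ^ 2) ^ (e / 2 - 1)‖ ≤ C * M * m ^ e := by
    intro x hx
    have ha := hpos.trans_le (hge x hx)
    set a := ‖(U x).1‖ with haa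
    have h1 := hCb (U x).2 (U x).1
    have h2 := l2norm_weighted_interp (U x).1
    rw [hmass x hx, ← haa] at h2
    rw [hU.l2norm_snd hs h0 hx, ← hM, ← haa] at h1
    have e1 : (a ^ 2) ^ (e / 2 - 1) = a ^ (e - 2) := by
      rw [← Real.rpow_natCast, ← Real.rpow_mul ha.le]; congr 1; push_cast; ring
    -- The exponents `1 + k/(k+1)` and `1/(k+1) - 2` add up to zero: the choice of `e` removes `a`
    -- from the bound.
    have e2 : a * a ^ ((k : ℝ) / (k + 1)) * a ^ (e - 2) = 1 := by
      rw [← Real.rpow_one_add' ha.le (by positivity), ← Real.rpow_add ha]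
      rw [show 1 + (k : ℝ) / (k + 1) + (e - 2) = 0 by rw [he]; field_simp; ring, Real.rpow_zero]
    have e3 : 0 < a ^ (e - 2) := Real.rpow_pos_of_pos ha _
    rw [e1, Real.norm_eq_abs, abs_mul, abs_mul, abs_mul, abs_mul, abs_of_pos e3,
      abs_of_pos (by positivity : 0 < e / 2), abs_of_pos (two_pos : (0 : ℝ) < 2)]
    have hme : 0 ≤ m ^ e := Real.rpow_nonneg hm0 _
    calc 2 * |c x| * |transfer (U x).2 (U x).1| * (e / 2) * a ^ (e - 2)
        ≤ 2 * 1 * (C * (M * (a * (a ^ ((k : ℝ) / (k + 1)) * m ^ e)))) * (1 / 2) * a ^ (e - 2) := by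
          gcongr
          · exact hc x
          · exact h1.trans (by gcongr)
      _ = C * M * m ^ e * (a * a ^ ((k : ℝ) / (k + 1)) * a ^ (e - 2)) := by ring
      _ = _ := by rw [e2, mul_one]
  have h3 := hs.norm_image_sub_le_of_norm_hasDerivWithin_le hder hbound h0 ht
  have e4 : ∀ x, (‖(U x).1‖ ^ 2) ^ (e / 2) = ‖(U x).1‖ ^ e := by
    intro x
    rw [← Real.rpow_natCast, ← Real.rpow_mul (norm_nonneg _)]; congr 1; push_cast; ring
  rw [e4, e4, Real.norm_eq_abs, sub_zero, Real.norm_eq_abs] at h3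
  have h4 : m ^ e ≤ ‖(U 0).1‖ ^ e := Real.rpow_le_rpow hm0 (hge 0 h0) he0.le
  have h5 : ‖(U t).1‖ ^ e ≤ ‖(U 0).1‖ ^ e * (1 + (C + 1) * M * |t|) := by
    have h6 := (abs_le.1 h3).2
    have h7 : C * M * m ^ e * |t| ≤ (C + 1) * M * ‖(U 0).1‖ ^ e * |t| := by gcongr; linarith
    linarith
  have h8 := pow_le_pow_left₀ (Real.rpow_nonneg (norm_nonneg _) _) h5 (k + 1)
  have e5 : ∀ x, (‖(U x).1‖ ^ e) ^ (k + 1) = ‖(U x).1‖ := by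
    intro x
    rw [← Real.rpow_natCast, ← Real.rpow_mul (norm_nonneg _), he]
    push_cast
    rw [one_div_mul_cancel hk.ne', Real.rpow_one]
  rwa [mul_pow, e5, e5] at h8

end L2E

namespace L2E

variable {k : ℕ}

/-! ### Solutions of the system -/

/-- Projections are unique, so the functions `w` of the definition are the values of `toeplitz`. -/
lemma IsSolution.hasDerivAt {u₀ v₀ : L2E k} {U : ℝ → L2E k × L2E k}
    (h : IsSolution (-1) u₀ v₀ U) (t : ℝ) : HasDerivAt U (field k (U t)) t := by
  have hd : HasDerivAt U (deriv U t) t :=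
    ((h.smooth.differentiable (by simp)) t).hasDerivAt
  convert hd using 1
  obtain ⟨w₁, hw₁, e₁⟩ := h.eq_u t
  obtain ⟨w₂, hw₂, e₂⟩ := h.eq_v t
  have p₁ := isProj_toeplitz (dens (U t).2) (U t).1
  have p₂ := isProj_toeplitz (dens (U t).1) (U t).2
  simp only [dens_apply] at p₁ p₂
  have q₁ := hw₁.unique p₁
  have q₂ := hw₂.unique p₂
  refine Prod.ext (ext fun z => ?_) (ext fun z => ?_)
  · have := e₁ z
    rw [q₁] at this
    simp only [field, smul_apply]
    rw [← this, ← mul_assoc]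
    simp
  · have := e₂ z
    rw [q₂] at this
    simp only [field, smul_apply]
    push_cast at this
    linear_combination Complex.I * this - (deriv U t).2 z * Complex.I_mul_I

lemma isSolution_of_hasDerivAt {U : ℝ → L2E k × L2E k}
    (h : ∀ t, HasDerivAt U (field k (U t)) t) : IsSolution (-1) (U 0).1 (U 0).2 U where
  smooth := contDiff_of_hasDerivAt contDiff_field h
  init := rfl
  eq_u t := by
    have p := isProj_toeplitz (dens (U t).2) (U t).1
    simp only [dens_apply] at p
    refine ⟨_, p, fun z => ?_⟩
    rw [(h t).deriv, field, smul_apply, ← mul_assoc]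
    simp
  eq_v t := by
    have p := isProj_toeplitz (dens (U t).1) (U t).2
    simp only [dens_apply] at p
    refine ⟨_, p, fun z => ?_⟩
    rw [(h t).deriv, field, smul_apply, ← mul_assoc, Complex.I_mul_I]
    simp

lemma isFlow_of_hasDerivAt {U : ℝ → L2E k × L2E k} (h : ∀ t, HasDerivAt U (field k (U t)) t)
    (s : Set ℝ) : IsFlow s (fun _ => 1) U := fun t _ => by
  rw [one_smul]; exact (h t).hasDerivWithinAt

/-- Global existence. -/
lemma exists_global_flow (U₀ : L2E k × L2E k) :
    ∃ U : ℝ → L2E k × L2E k, U 0 = U₀ ∧ ∀ t, HasDerivAt U (field k (U t)) t := by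
  obtain ⟨C, hC, hgr⟩ := exists_growth k
  refine exists_global_solution lipschitzOnWith_field fun T hT => ?_
  refine exists_solution_Icc (R := ‖U₀.1‖ * (1 + C * l2norm U₀.2 ^ 2 * T) ^ k +
    ‖U₀.2‖ * (1 + C * l2norm U₀.1 ^ 2 * T) ^ k) lipschitzOnWith_field hT ?_
  intro α c h0 hc hα t ht
  have hs : Convex ℝ (Set.Icc (-T) T) := convex_Icc _ _
  have hz : (0 : ℝ) ∈ Set.Icc (-T) T := ⟨by linarith, hT.le⟩
  have h1 := hgr _ c α hs hz hc hα t ht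
  have h2 := hgr _ (-c) _ hs hz (fun t => by simpa using hc t) (IsFlow.swap hα) t ht
  simp only [Prod.fst_swap, Prod.snd_swap] at h2
  rw [h0] at h1 h2
  have htT : |t| ≤ T := abs_le.2 ht
  refine norm_prod_le_iff.2 ⟨?_, ?_⟩
  · refine (h1.trans ?_).trans (le_add_of_nonneg_right (by positivity))
    gcongr
  · refine (h2.trans ?_).trans (le_add_of_nonneg_left (by positivity))
    gcongr

section Difference

variable {U : ℝ → L2E k × L2E k}

/-- The opposite signs of the two equations turn the difference of the squared norms into the sum of
the transfers, where the cancellation takes place. -/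
lemma hasDerivAt_norm_sq_sub (h : ∀ t, HasDerivAt U (field k (U t)) t) (t : ℝ) :
    HasDerivAt (fun t => ‖(U t).1‖ ^ 2 - ‖(U t).2‖ ^ 2)
      (2 * (transfer (U t).2 (U t).1 + transfer (U t).1 (U t).2)) t := by
  have hU := isFlow_of_hasDerivAt h Set.univ
  have h1 := (hU.hasDerivWithinAt_norm_sq_fst (Set.mem_univ t)).sub
    (hU.hasDerivWithinAt_norm_sq_snd (Set.mem_univ t))
  rw [hasDerivWithinAt_univ] at h1
  refine h1.congr_deriv ?_
  ring

lemma norm_sq_sub_eq (h : ∀ t, HasDerivAt U (field k (U t)) t)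
    (hz : ∀ v u : L2E k, transfer v u + transfer u v = 0) (t : ℝ) :
    ‖(U t).1‖ ^ 2 - ‖(U t).2‖ ^ 2 = ‖(U 0).1‖ ^ 2 - ‖(U 0).2‖ ^ 2 := by
  have hd : ∀ t, HasDerivAt (fun t => ‖(U t).1‖ ^ 2 - ‖(U t).2‖ ^ 2) 0 t := fun t => by
    have := hasDerivAt_norm_sq_sub h t
    rwa [hz, mul_zero] at this
  exact is_const_of_deriv_eq_zero (fun t => (hd t).differentiableAt) (fun t => (hd t).deriv) t 0

lemma exists_l2norm_weighted_le {j : ℕ} (hj : j ≤ k) (h : ∀ t, HasDerivAt U (field k (U t)) t) :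
    ∃ B : ℝ, 0 ≤ B ∧ ∀ t, l2norm (weighted j (U t).1) ≤ B * (1 + |t|) ^ j ∧
      l2norm (weighted j (U t).2) ≤ B * (1 + |t|) ^ j := by
  obtain ⟨C, hC, hgr⟩ := exists_growth j
  have hU := (isFlow_of_hasDerivAt h Set.univ).incl hj
  have hlin : ∀ (M t : ℝ), 0 ≤ M → (1 + C * M * |t|) ^ j ≤ (1 + C * M) ^ j * (1 + |t|) ^ j := by
    intro M t hM
    rw [← mul_pow]
    have := abs_nonneg t
    have := mul_nonneg hC.le hM
    gcongr
    nlinarith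
  set u₀ := L2E.incl hj (U 0).1
  set v₀ := L2E.incl hj (U 0).2
  refine ⟨‖u₀‖ * (1 + C * l2norm v₀ ^ 2) ^ j + ‖v₀‖ * (1 + C * l2norm u₀ ^ 2) ^ j,
    by positivity, fun t => ⟨?_, ?_⟩⟩
  · have h1 := hgr _ _ _ convex_univ (Set.mem_univ 0) (by simp) hU t (Set.mem_univ t)
    simp only [norm_incl hj (U t).1] at h1
    refine h1.trans ((mul_le_mul_of_nonneg_left (hlin _ t (sq_nonneg _)) (norm_nonneg _)).trans ?_)
    rw [← mul_assoc]
    exact mul_le_mul_of_nonneg_right (le_add_of_nonneg_right (by positivity)) (by positivity)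
  · have h1 := hgr _ _ _ convex_univ (Set.mem_univ 0) (by simp) hU.swap t (Set.mem_univ t)
    simp only [Prod.fst_swap, Prod.snd_swap, norm_incl hj (U t).2] at h1
    refine h1.trans ((mul_le_mul_of_nonneg_left (hlin _ t (sq_nonneg _)) (norm_nonneg _)).trans ?_)
    rw [← mul_assoc]
    exact mul_le_mul_of_nonneg_right (le_add_of_nonneg_left (by positivity)) (by positivity)

/-- Each norm with weight `n + 1` grows at most like `(1 + |t|)^(n+1)`, so the derivative is `O((1 +
|t|)^(2n+2))`; integrating in time adds one power. -/
lemma exists_abs_norm_sq_sub_le {n : ℕ} {U : ℝ → L2E (n + 2) × L2E (n + 2)}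
    (h : ∀ t, HasDerivAt U (field (n + 2) (U t)) t) :
    ∃ K : ℝ, ∀ t, |‖(U t).1‖ ^ 2 - ‖(U t).2‖ ^ 2| ≤ K * (1 + |t|) ^ (2 * n + 3) := by
  obtain ⟨c, hc, hT⟩ := exists_abs_transfer_add_transfer_le n
  obtain ⟨B, hB0, hB⟩ := exists_l2norm_weighted_le (Nat.le_succ (n + 1)) h
  have hU := isFlow_of_hasDerivAt h Set.univ
  have hm1 := fun t => hU.l2norm_fst convex_univ (Set.mem_univ 0) (Set.mem_univ t)
  have hm2 := fun t => hU.l2norm_snd convex_univ (Set.mem_univ 0) (Set.mem_univ t)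
  set a := l2norm (U 0).1
  set b := l2norm (U 0).2
  set D : ℝ := 2 * (c * ((b ^ 2 + a ^ 2) * B ^ 2)) with hD
  have hder : ∀ t, |2 * (transfer (U t).2 (U t).1 + transfer (U t).1 (U t).2)| ≤
      D * (1 + |t|) ^ (2 * n + 2) := by
    intro t
    have h1 := hT (U t).2 (U t).1
    rw [hm1, hm2] at h1
    obtain ⟨b1, b2⟩ := hB t
    have p1 := pow_le_pow_left₀ (l2norm_nonneg _) b1 2
    have p2 := pow_le_pow_left₀ (l2norm_nonneg _) b2 2
    rw [abs_mul, abs_of_pos (two_pos : (0 : ℝ) < 2)]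
    calc _ ≤ 2 * (c * (b ^ 2 * (B * (1 + |t|) ^ (n + 1)) ^ 2 +
          a ^ 2 * (B * (1 + |t|) ^ (n + 1)) ^ 2)) := by
          refine mul_le_mul_of_nonneg_left (h1.trans ?_) two_pos.le
          gcongr
      _ = _ := by rw [hD]; ring
  have hD0 : 0 ≤ D := by positivity
  refine ⟨|‖(U 0).1‖ ^ 2 - ‖(U 0).2‖ ^ 2| + D, fun t => ?_⟩
  have h3 := (convex_Icc (𝕜 := ℝ) (-|t|) |t|).norm_image_sub_le_of_norm_hasDerivWithin_le
    (C := D * (1 + |t|) ^ (2 * n + 2))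
    (fun x _ => (hasDerivAt_norm_sq_sub h x).hasDerivWithinAt) (fun x hx => by
      rw [Real.norm_eq_abs]
      refine (hder x).trans ?_
      have := abs_le.2 hx
      gcongr) (x := 0) (y := t) ⟨by simp, abs_nonneg t⟩ ⟨neg_abs_le t, le_abs_self t⟩
  rw [sub_zero, Real.norm_eq_abs, Real.norm_eq_abs] at h3
  have h4 := abs_sub_abs_le_abs_sub (‖(U t).1‖ ^ 2 - ‖(U t).2‖ ^ 2) (‖(U 0).1‖ ^ 2 - ‖(U 0).2‖ ^ 2)
  have h5 : 1 ≤ (1 + |t|) ^ (2 * n + 3) := one_le_pow₀ (by linarith [abs_nonneg t])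
  have h6 : D * (1 + |t|) ^ (2 * n + 2) * |t| ≤ D * (1 + |t|) ^ (2 * n + 3) := by
    rw [pow_succ _ (2 * n + 2), ← mul_assoc]
    gcongr
    linarith
  have h7 := mul_le_mul_of_nonneg_left h5 (abs_nonneg (‖(U 0).1‖ ^ 2 - ‖(U 0).2‖ ^ 2))
  rw [add_mul]
  linarith

end Difference

end L2E

end LLL

end

theorem theorem1p5 (k : ℕ) :
    ∃ C : ℝ, 0 < C ∧ ∀ u₀ v₀ : LLL.L2E k,
      ∃ U : ℝ → LLL.L2E k × LLL.L2E k,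
        LLL.IsSolution (-1) u₀ v₀ U ∧
        (∀ U' : ℝ → LLL.L2E k × LLL.L2E k, LLL.IsSolution (-1) u₀ v₀ U' → U' = U) ∧
        (∀ t : ℝ,
          LLL.l2norm (LLL.weighted k (U t).1) ≤
            LLL.l2norm (LLL.weighted k u₀) * (1 + C * LLL.l2norm v₀ ^ 2 * |t|) ^ k ∧
          LLL.l2norm (LLL.weighted k (U t).2) ≤
            LLL.l2norm (LLL.weighted k v₀) * (1 + C * LLL.l2norm u₀ ^ 2 * |t|) ^ k) ∧
        (2 ≤ k → ∃ K : ℝ, ∀ t : ℝ,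
          |LLL.l2norm (LLL.weighted k (U t).1) ^ 2 - LLL.l2norm (LLL.weighted k (U t).2) ^ 2| ≤
            K * (1 + |t|) ^ (2 * k - 1)) ∧
        (k ≤ 1 → ∃ K : ℝ, ∀ t : ℝ,
          |LLL.l2norm (LLL.weighted k (U t).1) ^ 2 - LLL.l2norm (LLL.weighted k (U t).2) ^ 2| ≤
            K) := by
  obtain ⟨C, hC, hgr⟩ := LLL.L2E.exists_growth k
  refine ⟨C, hC, fun u₀ v₀ => ?_⟩
  obtain ⟨U, h0, hU⟩ := LLL.L2E.exists_global_flow (u₀, v₀)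
  have hflow := LLL.L2E.isFlow_of_hasDerivAt hU Set.univ
  simp only [← LLL.L2E.norm_eq]
  refine ⟨U, ?_, fun U' hU' => ?_, fun t => ⟨?_, ?_⟩, fun hk => ?_, fun hk => ?_⟩
  · have := LLL.L2E.isSolution_of_hasDerivAt hU
    rwa [h0] at this
  · funext t
    exact LLL.eqOn_of_hasDerivAt LLL.L2E.lipschitzOnWith_field (T := |t| + 1)
      (fun s _ => LLL.L2E.IsSolution.hasDerivAt hU' s) (fun s _ => hU s) (hU'.init.trans h0.symm)
      (abs_lt.1 (lt_add_one |t|))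
  · have := hgr _ _ U convex_univ (Set.mem_univ 0) (by simp) hflow t (Set.mem_univ t)
    rwa [h0] at this
  · have := hgr _ _ _ convex_univ (Set.mem_univ 0) (by simp) hflow.swap t (Set.mem_univ t)
    simpa only [h0, Prod.fst_swap, Prod.snd_swap] using this
  · obtain ⟨n, rfl⟩ := Nat.exists_eq_add_of_le' hk
    -- For `k = n + 2`, the exponent `2 * k - 1` reduces to `2 * n + 3`.
    exact LLL.L2E.exists_abs_norm_sq_sub_le hU
  · have hz : ∀ v u : LLL.L2E k, LLL.L2E.transfer v u + LLL.L2E.transfer u v = 0 := by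
      interval_cases k
      · intro v u
        rw [LLL.L2E.transfer_eq_zero, LLL.L2E.transfer_eq_zero, add_zero]
      · exact LLL.L2E.transfer_add_transfer_eq_zero
    -- The difference is constant in time, so `K` is its absolute value at time `0`.
    exact ⟨_, fun t => (congrArg abs (LLL.L2E.norm_sq_sub_eq hU hz t)).le⟩
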